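/- Let $n\ge 2$. For $\varepsilon>0$, for sets $\mathcal A_1(x),\mathcal A_2(x)$ $(x\in\mathbb R^n)$ of Borel probability measures on $\mathbb R^n$ and for an open bounded set $\Omega\subset\mathbb R^n$, a bounded Borel function $u:\mathbb R^n\to\mathbb R$ satisfies the dynamic programming equation (DPP) on $\Omega$ if $$u(x)=\frac12\sup_{\mu\in\mathcal A_1(x)}\int u\,d\mu+\frac12\inf_{\mu\in\mathcal A_2(x)}\int u\,d\mu\qquad\text{for all }x\in\Omega .$$ Write $B(x,\varepsilon)$ for the open ball, $\delta_y$ for the Dirac measure at $y$, $U_{x,\varepsilon}$ for the uniform probability measure on $B(x,\varepsilon)$ and, for $\nu\ne0$, $D^\nu_{x,\varepsilon}$ for the uniform probability measure (with respect to $(n-1)$-dimensional Lebesgue measure) on the $(n-1)$-dimensional disc of centre $x$ and radius $\varepsilon$ in the hyperplane through $x$ with normal $\nu$. Consider the four games, in which $\mathcal A_1(x)=\mathcal A_2(x)=\mathcal A(x)$: (a) tug-of-war: $\mathcal A(x)=\{\delta_y: y\in B(x,\varepsilon)\}$; (b) the random walk: $\mathcal A(x)=\{U_{x,\varepsilon}\}$;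 (c) tug-of-war with noise and space dependent probabilities: $\mathcal A(x)=\{\alpha(x)\delta_y+(1-\alpha(x))U_{x,\varepsilon}: y\in B(x,\varepsilon)\}$, where $\alpha:\Omega\to[0,1]$ is an arbitrary Borel function; (d) tug-of-war with noise on hyperplane discs: $\mathcal A(x)=\{\alpha\,\delta_{x+\nu}+(1-\alpha)D^{\nu}_{x,\varepsilon}: 0<|\nu|\le\varepsilon\}$, where $\alpha\in(0,1]$ is a constant (for $1<p<\infty$ the choice $\alpha=\frac{p-1}{p+n}\in(0,1)$ corresponds to the $p$-Laplacian). **Theorem.** There is $\delta=\delta(n)\in(0,1)$, and there are positive constants $C_0,C_0'$, depending only on $n$ in the cases (a)–(c) and only on $n$ and $\alpha$ in the case (d), with the following property. Let $\varepsilon,R>0$, let $B(x_0,2R)\subset\Omega$, and let $u$ be a bounded Borel function that satisfies (DPP) on $\Omega$ for one of the games (a)–(d). Then for all $x,z\in B(x_0,R)$ $$|u(x)-u(z)|\le C\,\frac{|x-z|^\delta}{R^\delta}+C'\,\frac{\varepsilon^\delta}{R^\delta},$$ where $C=C_0\sup_{y,y'\in B(x_0,2R)}(u(y)-u(y'))$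 and $C'=C_0'\sup_{y,y'\in B(x_0,2R)}(u(y)-u(y'))$. -/

import Mathlib

open MeasureTheory Set Metric
open scoped ENNReal

noncomputable section

/-- `ℝⁿ` with the Euclidean norm. -/
abbrev Rn (n : ℕ) : Type := EuclideanSpace ℝ (Fin n)

/-- The dynamic programming equation on `Ω` for the families `A₁ x` and `A₂ x` of probability
measures at the disposal of the maximizer and of the minimizer at the point `x`:
`u(x) = ½ sup_{μ ∈ A₁(x)} ∫ u dμ + ½ inf_{μ ∈ A₂(x)} ∫ u dμ` for all `x ∈ Ω`.
The function `u` lives on all of `ℝⁿ`, because the measures may charge points outside `Ω`. -/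
def SatisfiesDPP {n : ℕ} (A₁ A₂ : Rn n → Set (Measure (Rn n))) (Ω : Set (Rn n))
    (u : Rn n → ℝ) : Prop :=
  ∀ x ∈ Ω, u x = 1 / 2 * sSup ((fun μ : Measure (Rn n) => ∫ y, u y ∂μ) '' A₁ x)
    + 1 / 2 * sInf ((fun μ : Measure (Rn n) => ∫ y, u y ∂μ) '' A₂ x)

/-- The uniform probability distribution on the open ball `B(x, ε)`. -/
def uniformBall {n : ℕ} (x : Rn n) (ε : ℝ) : Measure (Rn n) :=
  (volume (ball x ε))⁻¹ • volume.restrict (ball x ε)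

/-- The `(n-1)`-dimensional Lebesgue measure on the hyperplane `ν^⊥` through the origin. It is
spelled out through an orthonormal basis, since a subtype of `ℝⁿ` could also be given the
restriction of the `n`-dimensional Lebesgue measure. -/
def hyperplaneLebesgue {n : ℕ} (ν : Rn n) : Measure (Submodule.orthogonal (ℝ ∙ ν)) :=
  (stdOrthonormalBasis ℝ (Submodule.orthogonal (ℝ ∙ ν))).toBasis.addHaar

/-- The uniform probability distribution on the disc of centre `x` and radius `ε` in the
hyperplane through `x` with normal `ν`. -/
def uniformDisc {n : ℕ} (x ν : Rn n) (ε : ℝ) : Measure (Rn n) :=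
  ((hyperplaneLebesgue ν (ball 0 ε))⁻¹ • (hyperplaneLebesgue ν).restrict (ball 0 ε)).map
    (fun h : Submodule.orthogonal (ℝ ∙ ν) => x + (h : Rn n))

/-- Tug-of-war: the player who wins the toss moves to a point of `B(x, ε)` of his choice. -/
def tugOfWar {n : ℕ} (ε : ℝ) (x : Rn n) : Set (Measure (Rn n)) :=
  {μ | ∃ y ∈ ball x ε, μ = Measure.dirac y}

/-- The random walk: the next point is uniformly distributed in `B(x, ε)`. -/
def randomWalk {n : ℕ} (ε : ℝ) (x : Rn n) : Set (Measure (Rn n)) :=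
  {uniformBall x ε}

/-- Tug-of-war with noise and space dependent probabilities: with probability `α x` tug-of-war is
played, with probability `β x = 1 - α x` the next point is uniformly distributed in `B(x, ε)`. -/
def noisyTugOfWar {n : ℕ} (α : Rn n → ℝ) (ε : ℝ) (x : Rn n) : Set (Measure (Rn n)) :=
  {μ | ∃ y ∈ ball x ε,
    μ = ENNReal.ofReal (α x) • Measure.dirac y + ENNReal.ofReal (1 - α x) • uniformBall x ε}

/-- Tug-of-war with noise on hyperplane discs: the player who wins the toss has chosen a vector
`ν` with `0 < |ν| ≤ ε`; with probability `α` the next point is `x + ν`, and with probability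
`β = 1 - α` it is uniformly distributed in the disc of centre `x` and radius `ε` orthogonal
to `ν`. -/
def discTugOfWar {n : ℕ} (α ε : ℝ) (x : Rn n) : Set (Measure (Rn n)) :=
  {μ | ∃ ν : Rn n, 0 < ‖ν‖ ∧ ‖ν‖ ≤ ε ∧
    μ = ENNReal.ofReal α • Measure.dirac (x + ν) + ENNReal.ofReal (1 - α) • uniformDisc x ν ε}

/-- The oscillation `sup_{S × S} (u(y) - u(y'))`. -/
def oscOn {n : ℕ} (u : Rn n → ℝ) (S : Set (Rn n)) : ℝ :=
  sSup ((fun p : Rn n × Rn n => u p.1 - u p.2) '' (S ×ˢ S))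

/-- The asymptotic Hölder estimate in `B(x₀, R)` with exponent `δ`, constants `C`, `C'` and step
size `ε`, the right-hand side being proportional to the oscillation of `u` in `B(x₀, 2R)`. -/
def AsymptoticHolder {n : ℕ} (δ C C' ε : ℝ) (u : Rn n → ℝ) (x₀ : Rn n) (R : ℝ) : Prop :=
  ∀ x ∈ ball x₀ R, ∀ z ∈ ball x₀ R,
    |u x - u z| ≤ C * oscOn u (ball x₀ (2 * R)) * (‖x - z‖ ^ δ / R ^ δ)
      + C' * oscOn u (ball x₀ (2 * R)) * (ε ^ δ / R ^ δ)

end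

/-! Two copies of the game, started at `x` and `z`, are coupled so that a comparison function of the
pair decreases in the mean. Up to the oscillation `w` as a factor, `comparisonFun` has three terms:
a multiple of `(‖x - z‖ / R) ^ (2p)`, which gives the Hölder bound; a quadratic localization, which
is at least `1` once a point is `R / 2` away from the centre; and a bounded increasing function of a
discretized distance (`level`), of size `(ε / R) ^ (2p)`, which gives the error term. By
`le_of_excess_decrease` the differences of `u` are dominated as soon as every bound `F + K` improves
to `F + max (K - η) 0` with a fixed `η`. Hence only one-step estimates are needed;
`sub_le_comparisonFun` assembles them.

At distances of many `ε` (`FarGain`) the power is expanded to second order. It increases with the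
distance and is concave radially, and this concavity beats the other second-order terms if the
coupling cancels the first-order ones. Noise is coupled by a mirror reflection. For the players, the
steps of the maximizer at `x` and of the minimizer at `z` are given, and their opponents' steps may
be chosen as answers (`SatisfiesDPP.sub_le`). Almost maximal steps apart are reversed; otherwise the
answer pulls the points together, and the first-order gain, proportional to the distance, dominates.

At distances of a few `ε` (`NearGain`) no expansion is available; instead the level drops with a
probability bounded below. Geometric weights `θ ^ level` turn this into a decrease in the mean.

Tug-of-war and the random walk are the cases `α = 1` and `α = 0` of the game with variable
probabilities. There `α` is merely Borel, so one point may play tug-of-war while its neighbour only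
makes noise, and then they need not meet. The level therefore also records on which side of `1 / 2`
the values of `α` lie: first the points are brought to the same side, then they agree on the kind of
step with probability at least `1 / 2`. In the game on discs, noise in two different hyperplanes is
coupled by the reflection exchanging the unit normals. -/

/-! ### Second-order expansion of powers of the norm -/

/-- The second-order expansion of `(1 + s) ^ p`, as an upper bound. -/
theorem one_add_rpow_le {p s : ℝ} (hp : 0 < p) (hp1 : p ≤ 1) (hs : |s| ≤ 1 / 2) :
    (1 + s) ^ p ≤ 1 + p * s - p * (1 - p) / 2 * s ^ 2 + 6 * p * |s| ^ 3 := by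
  obtain ⟨hs1, hs2⟩ := abs_le.1 hs
  have h0 : 0 < 1 + s := by linarith
  have hlog : Real.log (1 + s) ≤ s - s ^ 2 / 2 + 2 * |s| ^ 3 := by
    have h := Real.abs_log_sub_add_sum_range_le (x := -s) (by rw [abs_neg]; linarith) 2
    simp only [Finset.sum_range_succ, Finset.sum_range_zero, abs_neg] at h
    have h2 : |s| ^ (2 + 1) / (1 - |s|) ≤ 2 * |s| ^ 3 := by
      rw [div_le_iff₀ (by linarith)]
      have : 0 ≤ |s| ^ 3 := by positivity
      have h1 : 0 ≤ |s| ^ 3 * (1 - 2 * |s|) := mul_nonneg this (by linarith)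
      norm_num
      linarith
    have h3 := (abs_le.1 (h.trans h2)).2
    rw [sub_neg_eq_add] at h3
    norm_num at h3
    linarith
  set a := |s| with ha
  have ha0 : 0 ≤ a := abs_nonneg s
  have hsa : s ^ 2 = a ^ 2 := (sq_abs s).symm
  set y := s - s ^ 2 / 2 + 2 * a ^ 3 with hy
  have hsa' : -a ≤ s ∧ s ≤ a := abs_le.1 le_rfl
  have hya : |y| ≤ 7 / 4 * a := by
    rw [abs_le, hy, hsa]
    constructor <;> nlinarith [mul_nonneg ha0 ha0, mul_nonneg (mul_nonneg ha0 ha0) ha0]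
  have hpy : |p * y| ≤ 1 := by
    rw [abs_mul, abs_of_pos hp]
    nlinarith [abs_nonneg y]
  have hexp : Real.exp (p * y) ≤ 1 + p * y + (p * y) ^ 2 / 2 + 2 / 9 * |p * y| ^ 3 := by
    have h := Real.exp_bound hpy (n := 3) (by norm_num)
    simp only [Finset.sum_range_succ, Finset.sum_range_zero] at h
    have h3 := (abs_le.1 h).2
    norm_num [Nat.factorial] at h3
    rw [abs_mul]
    linarith
  have hy2 : y ^ 2 ≤ s ^ 2 + 9 / 2 * a ^ 3 := by
    have he : |y - s| ≤ 3 / 2 * a ^ 2 := by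
      rw [abs_le, hy, hsa]
      constructor <;> nlinarith [mul_nonneg ha0 ha0, mul_nonneg (mul_nonneg ha0 ha0) ha0]
    have h1 : s * (y - s) ≤ a * (3 / 2 * a ^ 2) :=
      (le_abs_self _).trans (by rw [abs_mul]; gcongr)
    have h2 : (y - s) ^ 2 ≤ (3 / 2 * a ^ 2) ^ 2 := sq_le_sq' (by linarith [(abs_le.1 he).1]) (abs_le.1 he).2
    have h3 : (3 / 2 * a ^ 2) ^ 2 ≤ 9 / 8 * a ^ 3 := by
      have : 0 ≤ a ^ 3 := by positivity
      nlinarith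
    nlinarith
  have hy3 : |p * y| ^ 3 ≤ p * (343 / 64 * a ^ 3) := by
    rw [abs_mul, abs_of_pos hp, mul_pow]
    have h1 : p ^ 3 ≤ p := by nlinarith [mul_pos hp hp]
    have h2 : |y| ^ 3 ≤ (7 / 4 * a) ^ 3 := by gcongr
    calc p ^ 3 * |y| ^ 3 ≤ p * (7 / 4 * a) ^ 3 := by gcongr
      _ = _ := by ring
  -- Writing the power as `exp (p * log (1 + s))`, the factor `p` stays in front of every error
  -- term.
  have hmain : (1 + s) ^ p ≤ Real.exp (p * y) := by
    rw [Real.rpow_def_of_pos h0, mul_comm]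
    exact Real.exp_le_exp.2 (mul_le_mul_of_nonneg_left hlog hp.le)
  have ha3 : 0 ≤ a ^ 3 := by positivity
  have h5 : (p * y) ^ 2 ≤ p ^ 2 * s ^ 2 + p * (9 / 2 * a ^ 3) := by
    have : p ^ 2 * y ^ 2 ≤ p ^ 2 * (s ^ 2 + 9 / 2 * a ^ 3) := by gcongr
    have h6 : p ^ 2 * (9 / 2 * a ^ 3) ≤ p * (9 / 2 * a ^ 3) := by
      gcongr; nlinarith
    nlinarith
  have h7 : 0 ≤ p * a ^ 3 := by positivity
  have h8 : p * y = p * s - p * s ^ 2 / 2 + 2 * (p * a ^ 3) := by rw [hy]; ring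
  nlinarith

/-- The second-order expansion of `‖·‖ ^ (2 p)` around `d v`, as an upper bound. -/
theorem norm_sq_rpow_add_le {n : ℕ} {p d ε : ℝ} (hp : 0 < p) (hp1 : p ≤ 1) (hε : 0 < ε)
    (hd : 16 * ε ≤ d) {v k : Rn n} (hv : ‖v‖ = 1) (hk : ‖k‖ ≤ 2 * ε) :
    (‖d • v + k‖ ^ 2) ^ p ≤ (d ^ 2) ^ p + p * (d ^ 2) ^ (p - 1) *
      (2 * d * inner ℝ k v + ‖k‖ ^ 2 - 2 * (1 - p) * inner ℝ k v ^ 2 + 3200 * ε ^ 3 / d) := by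
  have hd0 : 0 < d := by linarith
  set l := inner ℝ k v with hl
  have hl1 : |l| ≤ 2 * ε := by
    calc |l| ≤ ‖k‖ * ‖v‖ := abs_real_inner_le_norm k v
      _ ≤ 2 * ε := by rw [hv, mul_one]; exact hk
  set q := ‖k‖ ^ 2 with hq
  have hq0 : 0 ≤ q := by positivity
  have hq1 : q ≤ 4 * ε ^ 2 := by
    rw [hq]; nlinarith [norm_nonneg k]
  set s := (2 * d * l + q) / d ^ 2 with hs
  have hsd : s * d ^ 2 = 2 * d * l + q := by rw [hs]; field_simp
  have hnorm : ‖d • v + k‖ ^ 2 = d ^ 2 * (1 + s) := by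
    rw [norm_add_sq_real, norm_smul, hv, real_inner_smul_left, real_inner_comm, ← hl, ← hq]
    rw [mul_add, mul_comm (d ^ 2) s, hsd]
    simp [sq_abs]
    ring
  set r := ε / d with hr
  have hr0 : 0 < r := by positivity
  have hr1 : r ≤ 1 / 16 := by rw [hr, div_le_iff₀ hd0]; linarith
  have hrd : ε = r * d := by rw [hr]; field_simp
  have hs8 : |s| ≤ 8 * r := by
    rw [hs, abs_div, abs_of_pos (by positivity : 0 < d ^ 2), div_le_iff₀ (by positivity)]
    have h1 : |2 * d * l + q| ≤ 2 * d * (2 * ε) + 4 * ε ^ 2 := by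
      refine (abs_add_le _ _).trans ?_
      rw [abs_mul, abs_of_nonneg hq0, abs_of_pos (by positivity : 0 < 2 * d)]
      gcongr
    refine h1.trans ?_
    rw [hrd]
    nlinarith [mul_pos hr0 (mul_pos hd0 hd0)]
  have hs2 : |s| ≤ 1 / 2 := by linarith
  have key := one_add_rpow_le hp hp1 hs2
  have h1s : 0 < 1 + s := by linarith [(abs_le.1 hs2).1]
  rw [hnorm, Real.mul_rpow (by positivity) h1s.le]
  have hdp : (d ^ 2) ^ p = (d ^ 2) ^ (p - 1) * d ^ 2 := by
    rw [Real.rpow_sub (by positivity), Real.rpow_one]; field_simp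
  have hD : 0 < (d ^ 2) ^ (p - 1) := by positivity
  have hs3 : |s| ^ 3 * d ^ 2 ≤ 512 * (ε ^ 3 / d) := by
    have : |s| ^ 3 ≤ (8 * r) ^ 3 := by gcongr
    have h2 : ε ^ 3 / d = r ^ 3 * d ^ 2 := by rw [hr]; field_simp
    rw [h2]
    nlinarith [mul_pos hd0 hd0]
  have hssq : 4 * l ^ 2 - 32 * (ε ^ 3 / d) ≤ s ^ 2 * d ^ 2 := by
    have h2 : s ^ 2 * d ^ 2 = 4 * l ^ 2 + 4 * (l * q) / d + q ^ 2 / d ^ 2 := by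
      rw [hs]; field_simp; ring
    have h3 : -(8 * ε ^ 3) ≤ l * q := by
      have : |l * q| ≤ 2 * ε * (4 * ε ^ 2) := by
        rw [abs_mul, abs_of_nonneg hq0]; gcongr
      linarith [(abs_le.1 this).1]
    have h4 : -(32 * (ε ^ 3 / d)) ≤ 4 * (l * q) / d := by
      rw [← mul_div_assoc, ← neg_div]
      gcongr
      linarith
    have h5 : 0 ≤ q ^ 2 / d ^ 2 := by positivity
    linarith
  have hE : 0 < ε ^ 3 / d := by positivity
  have hfin : d ^ 2 * (1 + p * s - p * (1 - p) / 2 * s ^ 2 + 6 * p * |s| ^ 3) ≤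
      d ^ 2 + p * (2 * d * l + q - 2 * (1 - p) * l ^ 2 + 3200 * (ε ^ 3 / d)) := by
    have h1 : p * (1 - p) / 2 * (4 * l ^ 2 - 32 * (ε ^ 3 / d)) ≤ p * (1 - p) / 2 * (s ^ 2 * d ^ 2) := by
      apply mul_le_mul_of_nonneg_left hssq
      have : 0 ≤ 1 - p := by linarith
      positivity
    have h2 : 6 * p * (|s| ^ 3 * d ^ 2) ≤ 6 * p * (512 * (ε ^ 3 / d)) := by gcongr
    have h3 : p * (1 - p) / 2 * (32 * (ε ^ 3 / d)) ≤ p * (16 * (ε ^ 3 / d)) := by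
      have : (1 - p) * (16 * (ε ^ 3 / d)) ≤ 1 * (16 * (ε ^ 3 / d)) := by
        gcongr; linarith
      nlinarith
    have h4 : p * (s * d ^ 2) = p * (2 * d * l + q) := by rw [hsd]
    have h5 : 0 < p * (ε ^ 3 / d) := by positivity
    nlinarith
  rw [hdp]
  calc (d ^ 2) ^ (p - 1) * d ^ 2 * (1 + s) ^ p
      ≤ (d ^ 2) ^ (p - 1) * (d ^ 2 * (1 + p * s - p * (1 - p) / 2 * s ^ 2 + 6 * p * |s| ^ 3)) := by
        rw [mul_assoc]; gcongr
    _ ≤ (d ^ 2) ^ (p - 1) *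
        (d ^ 2 + p * (2 * d * l + q - 2 * (1 - p) * l ^ 2 + 3200 * (ε ^ 3 / d))) := by gcongr
    _ = _ := by ring

/-! ### Levels and the one-step gain conditions -/

open Classical in
/-- The level of a pair of points, a bounded discretization of their distance on the scale `ε`
that also records whether the property `τ` distinguishes the two points. -/
noncomputable def level {n : ℕ} (τ : Rn n → Prop) (ε : ℝ) (x z : Rn n) : ℕ :=
  if x = z then 0 else if (τ x ↔ τ z) ∧ ‖x - z‖ ≤ 3 / 2 * ε then 1 else
    if ‖x - z‖ ≤ ε / 2 then 2 else 3 + ⌊10 * (‖x - z‖ / ε - 1 / 2)⌋₊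

/-- The next positions can be coupled so that the level drops with probability at least `c`. -/
def NearGain {n : ℕ} (c ε : ℝ) (τ : Rn n → Prop) (u : Rn n → ℝ) (x z : Rn n) : Prop :=
  x ≠ z → ∀ T s : ℝ, 0 ≤ s →
    (∀ X ∈ closedBall x ε, ∀ Z ∈ closedBall z ε, u X - u Z ≤ T) →
    (∀ X ∈ closedBall x ε, ∀ Z ∈ closedBall z ε, level τ ε X Z < level τ ε x z →
      u X - u Z ≤ T - s) →
    u x - u z ≤ T - c * s

/-- The increment of the comparison function, in units of its tangential second derivative, when
`h` and `g` are added to two points whose difference is `d v`. -/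
noncomputable def quadIncrement {n : ℕ} (p σ ε d : ℝ) (v a b h g : Rn n) : ℝ :=
  2 * d * inner ℝ (h - g) v + d * (inner ℝ a h + inner ℝ b g) + ‖h - g‖ ^ 2
    - 2 * (1 - p) * inner ℝ (h - g) v ^ 2 + σ * ε ^ 2

/-- The next positions of two distant points can be coupled so that the expected increment of the
comparison function is negative. -/
def FarGain {n : ℕ} (p N σ κ ε : ℝ) (u : Rn n → ℝ) (x z : Rn n) : Prop :=
  ∀ (T Λ d : ℝ) (v a b : Rn n), 0 < Λ → N * ε ≤ d → ‖v‖ = 1 → ‖a‖ ≤ σ → ‖b‖ ≤ σ →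
    (∀ h g : Rn n, ‖h‖ ≤ ε → ‖g‖ ≤ ε →
      u (x + h) - u (z + g) ≤ T + Λ * quadIncrement p σ ε d v a b h g) →
    u x - u z ≤ T - Λ * κ * ε ^ 2

theorem level_self {n : ℕ} (τ : Rn n → Prop) (ε : ℝ) (x : Rn n) : level τ ε x x = 0 := by
  simp [level]

theorem level_pos {n : ℕ} {τ : Rn n → Prop} {ε : ℝ} {x z : Rn n} (h : x ≠ z) :
    0 < level τ ε x z := by
  unfold level
  rw [if_neg h]
  split_ifs <;> omega

theorem level_le_one {n : ℕ} {τ : Rn n → Prop} {ε : ℝ} {x z : Rn n} (ht : τ x ↔ τ z)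
    (h : ‖x - z‖ ≤ 3 / 2 * ε) : level τ ε x z ≤ 1 := by
  unfold level
  rw [if_pos (show (τ x ↔ τ z) ∧ ‖x - z‖ ≤ 3 / 2 * ε from ⟨ht, h⟩)]
  split_ifs <;> omega

theorem level_cases {n : ℕ} (τ : Rn n → Prop) {ε : ℝ} {x z : Rn n} (hxz : x ≠ z) :
    (level τ ε x z = 1 ∧ (τ x ↔ τ z) ∧ ‖x - z‖ ≤ 3 / 2 * ε) ∨
    (level τ ε x z = 2 ∧ ‖x - z‖ ≤ ε / 2) ∨
    (level τ ε x z = 3 + ⌊10 * (‖x - z‖ / ε - 1 / 2)⌋₊ ∧ ε / 2 < ‖x - z‖) := by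
  unfold level
  rw [if_neg hxz]
  split_ifs with h1 h2
  · exact Or.inl ⟨rfl, h1⟩
  · exact Or.inr (Or.inl ⟨rfl, h2⟩)
  · exact Or.inr (Or.inr ⟨rfl, not_le.1 h2⟩)

/-- Above level two, the level drops when the distance shrinks by `ε / 10`. -/
theorem level_lt_of_norm_le {n : ℕ} {τ : Rn n → Prop} {ε : ℝ} (hε : 0 < ε) {x z X Z : Rn n}
    (hl : level τ ε x z = 3 + ⌊10 * (‖x - z‖ / ε - 1 / 2)⌋₊)
    (h : ‖X - Z‖ ≤ ‖x - z‖ - ε / 10) : level τ ε X Z < level τ ε x z := by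
  rw [hl]
  by_cases hXZ : X = Z
  · rw [hXZ, level_self]; omega
  rcases level_cases τ (ε := ε) hXZ with h1 | h1 | h1
  · omega
  · omega
  · rw [h1.1]
    have h2 : ‖X - Z‖ / ε ≤ ‖x - z‖ / ε - 1 / 10 := by
      rw [div_le_iff₀ hε, sub_mul, div_mul_cancel₀ _ hε.ne']
      linarith
    have h3 : 1 / 2 < ‖X - Z‖ / ε := by
      rw [lt_div_iff₀ hε]; linarith [h1.2]
    have h4 : ⌊10 * (‖X - Z‖ / ε - 1 / 2)⌋₊ + 1 ≤ ⌊10 * (‖x - z‖ / ε - 1 / 2)⌋₊ := by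
      rw [Nat.le_floor_iff (by linarith)]
      push_cast
      have := Nat.floor_le (a := 10 * (‖X - Z‖ / ε - 1 / 2)) (by linarith)
      linarith
    omega

theorem norm_le_of_level_lt {n : ℕ} {τ : Rn n → Prop} {ε : ℝ} (hε : 0 < ε) {x z : Rn n} {m : ℕ}
    (h : level τ ε x z < m) (hm : 4 ≤ m) : ‖x - z‖ ≤ m * ε := by
  have hm' : (4 : ℝ) ≤ m := by exact_mod_cast hm
  by_cases hxz : x = z
  · rw [hxz, sub_self, norm_zero]; positivity
  rcases level_cases τ (ε := ε) hxz with h1 | h1 | h1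
  · nlinarith [h1.2.2]
  · nlinarith [h1.2]
  · rw [h1.1] at h
    have h2 := Nat.lt_floor_add_one (10 * (‖x - z‖ / ε - 1 / 2))
    have h3 : ((3 + ⌊10 * (‖x - z‖ / ε - 1 / 2)⌋₊ : ℕ) : ℝ) < m := by exact_mod_cast h
    push_cast at h3
    have h4 : ‖x - z‖ / ε ≤ m := by linarith
    rwa [div_le_iff₀ hε] at h4

theorem le_norm_of_le_level {n : ℕ} {τ : Rn n → Prop} {ε : ℝ} (hε : 0 < ε) {x z : Rn n} {m : ℕ}
    (h : m ≤ level τ ε x z) (hm : 4 ≤ m) : ((m : ℝ) - 3) / 10 * ε ≤ ‖x - z‖ := by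
  by_cases hxz : x = z
  · rw [hxz, level_self] at h; omega
  rcases level_cases τ (ε := ε) hxz with h1 | h1 | h1
  · omega
  · omega
  · rw [h1.1] at h
    have h3 : (m : ℝ) ≤ ((3 + ⌊10 * (‖x - z‖ / ε - 1 / 2)⌋₊ : ℕ) : ℝ) := by exact_mod_cast h
    push_cast at h3
    have h5 : 1 / 2 < ‖x - z‖ / ε := by
      rw [lt_div_iff₀ hε]; linarith [h1.2]
    have h2 := Nat.floor_le (a := 10 * (‖x - z‖ / ε - 1 / 2)) (by linarith)
    have h4 : ((m : ℝ) - 3) / 10 ≤ ‖x - z‖ / ε := by linarith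
    rwa [le_div_iff₀ hε] at h4

/-! ### Comparison principle and comparison function -/

/-- The comparison principle: an excess over the comparison function that can always be lowered
by a fixed amount is zero. -/
theorem le_of_excess_decrease {α : Type*} {u : α → ℝ} {B : Set α} {F : α → α → ℝ} {w η : ℝ}
    (hη : 0 < η) (hw : ∀ x ∈ B, ∀ z ∈ B, u x - u z ≤ w) (hF : ∀ x ∈ B, ∀ z ∈ B, 0 ≤ F x z)
    (h : ∀ x ∈ B, ∀ z ∈ B, ∀ K : ℝ, 0 ≤ K → (∀ X ∈ B, ∀ Z ∈ B, u X - u Z ≤ F X Z + K) →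
      u x - u z ≤ F x z + max (K - η) 0) :
    ∀ x ∈ B, ∀ z ∈ B, u x - u z ≤ F x z := by
  have key : ∀ k : ℕ, ∀ x ∈ B, ∀ z ∈ B, u x - u z ≤ F x z + max (w - k * η) 0 := by
    intro k
    induction k with
    | zero =>
      intro x hx z hz
      have := le_max_left (w - (0 : ℕ) * η) 0
      have h1 := hw x hx z hz
      have h2 := hF x hx z hz
      push_cast at this ⊢
      linarith
    | succ k ih =>
      intro x hx z hz
      refine (h x hx z hz _ (le_max_right _ _) ih).trans (add_le_add_right ?_ _)
      refine max_le ?_ (le_max_right _ _)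
      push_cast
      rcases le_total (w - k * η) 0 with h1 | h1
      · rw [max_eq_right h1]
        exact le_max_of_le_right (by linarith)
      · rw [max_eq_left h1]
        exact le_max_of_le_left (by linarith)
  intro x hx z hz
  obtain ⟨k, hk⟩ := exists_nat_ge (w / η)
  have h1 := key k x hx z hz
  rw [div_le_iff₀ hη] at hk
  rwa [max_eq_right (by linarith), add_zero] at h1

theorem le_sq_rpow {p r : ℝ} (hp2 : p ≤ 1 / 2) (hr : 0 < r) (hr1 : r ≤ 1) :
    r ≤ (r ^ 2) ^ p := by
  rw [← Real.rpow_natCast, ← Real.rpow_mul hr.le]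
  nth_rw 1 [← Real.rpow_one r]
  apply Real.rpow_le_rpow_of_exponent_ge hr hr1
  push_cast
  linarith

/-- The comparison function. -/
noncomputable def comparisonFun {n : ℕ} (p C K θ ε R w : ℝ) (m : ℕ) (τ : Rn n → Prop) (y : Rn n)
    (x z : Rn n) : ℝ :=
  w * (C * (‖x - z‖ ^ 2 / R ^ 2) ^ p + 4 * (‖x - y‖ ^ 2 + ‖z - y‖ ^ 2) / R ^ 2
    + K * (ε ^ 2 / R ^ 2) ^ p * (1 - θ ^ (min (level τ ε x z) m)))

section Comparison

variable {n : ℕ} {p C K θ ε R w c N σ κ : ℝ} {m : ℕ} {τ : Rn n → Prop} {y : Rn n} {u : Rn n → ℝ}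

/-- Here `Λ` is the unit of the power term at distance `d`. The second inequality controls the
gradient of the localization, the third its Hessian; both follow from `16 ≤ C * p * σ` and `d / R ≤
(d / R) ^ (2p)`. -/
theorem far_constants (hp : 0 < p) (hp2 : p ≤ 1 / 2) (hR : 0 < R) (hw : 0 < w) (hσ : 0 < σ)
    (hC0 : 0 < C) (hC : 16 ≤ C * p * σ) {d : ℝ} (hd0 : 0 < d) (hdR : d ≤ R) :
    w * C * p / R ^ 2 ≤ w * C * p * (d ^ 2) ^ (p - 1) / (R ^ 2) ^ p ∧
    4 * w / R ^ 2 * R ≤ σ * (w * C * p * (d ^ 2) ^ (p - 1) / (R ^ 2) ^ p * d) ∧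
    4 * (4 * w / R ^ 2) ≤ σ * (w * C * p * (d ^ 2) ^ (p - 1) / (R ^ 2) ^ p) := by
  set Λ := w * C * p * (d ^ 2) ^ (p - 1) / (R ^ 2) ^ p with hΛ
  have hdp : (d ^ 2) ^ (p - 1) * d ^ 2 = (d ^ 2) ^ p := by
    rw [Real.rpow_sub (by positivity), Real.rpow_one]; field_simp
  have hΛd2 : Λ * d ^ 2 = w * C * p * ((d / R) ^ 2) ^ p := by
    rw [div_pow, Real.div_rpow (by positivity) (by positivity), ← hdp, hΛ]; ring
  have hr1 : d / R ≤ 1 := by rw [div_le_one hR]; exact hdR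
  have hrp : d / R ≤ ((d / R) ^ 2) ^ p := le_sq_rpow hp2 (by positivity) hr1
  have hΛd : w * C * p / R ≤ Λ * d := by
    have h1 : w * C * p * (d / R) ≤ Λ * d ^ 2 := by rw [hΛd2]; gcongr
    have h2 : w * C * p / R * d ≤ Λ * d * d := by
      calc w * C * p / R * d = w * C * p * (d / R) := by ring
        _ ≤ Λ * d ^ 2 := h1
        _ = _ := by ring
    exact le_of_mul_le_mul_right h2 hd0
  have hΛ1 : w * C * p / R ^ 2 ≤ Λ := by
    have h2 : w * C * p / R ^ 2 * R ≤ Λ * R := by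
      calc w * C * p / R ^ 2 * R = w * C * p / R := by field_simp
        _ ≤ Λ * d := hΛd
        _ ≤ Λ * R := by gcongr
    exact le_of_mul_le_mul_right h2 hR
  refine ⟨hΛ1, ?_, ?_⟩
  · have h1 : σ * (w * C * p / R) ≤ σ * (Λ * d) := by gcongr
    refine le_trans ?_ h1
    have : 4 * w / R ^ 2 * R = w * 4 / R := by field_simp
    rw [this, mul_div_assoc', div_le_div_iff_of_pos_right hR]
    nlinarith
  · have h1 : σ * (w * C * p / R ^ 2) ≤ σ * Λ := by gcongr
    refine le_trans ?_ h1
    rw [mul_div_assoc', mul_div_assoc', div_le_div_iff_of_pos_right (by positivity)]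
    nlinarith

/-- The scaled vectors `x - y` and `z - y` become the drifts `a` and `b` of `quadIncrement`. -/
theorem localization_expansion {M Λ d : ℝ} (hΛ : 0 < Λ) (hd : 0 < d) (x z h g : Rn n) :
    M * (‖x + h - y‖ ^ 2 + ‖z + g - y‖ ^ 2) = M * (‖x - y‖ ^ 2 + ‖z - y‖ ^ 2)
      + Λ * (d * (inner ℝ ((2 * M / (Λ * d)) • (x - y)) h
        + inner ℝ ((2 * M / (Λ * d)) • (z - y)) g)) + M * (‖h‖ ^ 2 + ‖g‖ ^ 2) := by
  rw [add_sub_right_comm, norm_add_sq_real, add_sub_right_comm, norm_add_sq_real,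
    real_inner_smul_left, real_inner_smul_left]
  field_simp
  ring

/-- From level `m` on, the truncated level term is at its maximum and can only drop, so just the
power and the localization matter. Half of the slack `σ * ε ^ 2` in `quadIncrement` absorbs the
cubic error, because the distance is at least `6400 / σ * ε`; the other half absorbs the quadratic
part of the localization. -/
theorem comparisonFun_far_le (hp : 0 < p) (hp2 : p ≤ 1 / 2) (hε : 0 < ε) (hR : 0 < R)
    (hw : 0 < w) (hσ : 0 < σ) (hC0 : 0 < C) (hC : 16 ≤ C * p * σ) (hK : 0 < K)
    (hθ : 0 < θ) (hθ1 : θ < 1) (hm : 4 ≤ m) (hm1 : 6400 / σ ≤ ((m : ℝ) - 3) / 10)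
    (hm2 : 16 ≤ ((m : ℝ) - 3) / 10) {x z : Rn n}
    (hx : ‖x - y‖ < R / 2) (hz : ‖z - y‖ < R / 2) (hlev : m ≤ level τ ε x z) :
    ∃ (Λ : ℝ) (v a b : Rn n), w * C * p / R ^ 2 ≤ Λ ∧ ‖v‖ = 1 ∧ ‖a‖ ≤ σ ∧ ‖b‖ ≤ σ ∧
      ∀ h g : Rn n, ‖h‖ ≤ ε → ‖g‖ ≤ ε →
        comparisonFun p C K θ ε R w m τ y (x + h) (z + g) ≤
          comparisonFun p C K θ ε R w m τ y x z
            + Λ * quadIncrement p σ ε ‖x - z‖ v a b h g := by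
  have hdε := le_norm_of_le_level hε hlev hm
  have hd1 : 6400 / σ * ε ≤ ‖x - z‖ := (by gcongr : _ ≤ ((m : ℝ) - 3) / 10 * ε).trans hdε
  have hd2 : 16 * ε ≤ ‖x - z‖ := (by gcongr : _ ≤ ((m : ℝ) - 3) / 10 * ε).trans hdε
  have hd0 : 0 < ‖x - z‖ := by linarith
  have hdR : ‖x - z‖ ≤ R := by
    have : x - z = (x - y) - (z - y) := by abel
    rw [this]
    linarith [norm_sub_le (x - y) (z - y)]
  obtain ⟨v, hv, hdv⟩ : ∃ v : Rn n, ‖v‖ = 1 ∧ ‖x - z‖ • v = x - z := by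
    refine ⟨(1 / ‖x - z‖) • (x - z), ?_, ?_⟩
    · rw [norm_smul, Real.norm_of_nonneg (by positivity)]; field_simp
    · rw [smul_smul, mul_one_div_cancel hd0.ne', one_smul]
  obtain ⟨hΛ1, hMR, hMΛ⟩ := far_constants hp hp2 hR hw hσ hC0 hC hd0 hdR
  have hlev' : ∀ X Z : Rn n, θ ^ m ≤ θ ^ (min (level τ ε X Z) m) := fun X Z =>
    pow_le_pow_of_le_one hθ.le hθ1.le (min_le_right _ _)
  have hpow : ∀ t : ℝ, (t ^ 2 / R ^ 2) ^ p = (t ^ 2) ^ p / (R ^ 2) ^ p := fun t =>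
    Real.div_rpow (by positivity) (by positivity) p
  have hkey : ∀ h g : Rn n, ‖h‖ ≤ ε → ‖g‖ ≤ ε →
      (‖x + h - (z + g)‖ ^ 2) ^ p ≤ (‖x - z‖ ^ 2) ^ p + p * (‖x - z‖ ^ 2) ^ (p - 1) *
      (2 * ‖x - z‖ * inner ℝ (h - g) v + ‖h - g‖ ^ 2 - 2 * (1 - p) * inner ℝ (h - g) v ^ 2
        + 3200 * ε ^ 3 / ‖x - z‖) := by
    intro h g hh hg
    have hk : ‖h - g‖ ≤ 2 * ε := (norm_sub_le h g).trans (by linarith)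
    have h1 := norm_sq_rpow_add_le hp (by linarith) hε hd2 hv hk
    have : x + h - (z + g) = ‖x - z‖ • v + (h - g) := by rw [hdv]; abel
    rwa [this]
  unfold comparisonFun quadIncrement
  simp only [hpow, min_eq_right hlev]
  generalize ‖x - z‖ = d at *
  set Λ := w * C * p * (d ^ 2) ^ (p - 1) / (R ^ 2) ^ p with hΛ
  have hΛ0 : 0 < Λ := by positivity
  set M := 4 * w / R ^ 2 with hM
  have hM0 : 0 < M := by positivity
  have hbound : ∀ t : Rn n, ‖t - y‖ < R / 2 → ‖(2 * M / (Λ * d)) • (t - y)‖ ≤ σ := by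
    intro t ht
    rw [norm_smul, Real.norm_of_nonneg (by positivity), div_mul_eq_mul_div,
      div_le_iff₀ (by positivity)]
    nlinarith
  refine ⟨Λ, v, (2 * M / (Λ * d)) • (x - y), (2 * M / (Λ * d)) • (z - y), hΛ1, hv,
    hbound x hx, hbound z hz, ?_⟩
  intro h g hh hg
  have h0 := hkey h g hh hg
  have hpos : 0 ≤ w * C / (R ^ 2) ^ p := by positivity
  have h2 := mul_le_mul_of_nonneg_left h0 hpos
  have h3 : 3200 * ε ^ 3 / d ≤ σ / 2 * ε ^ 2 := by
    rw [div_le_iff₀ hd0]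
    have : 6400 * ε ≤ d * σ := by
      rw [div_mul_eq_mul_div, div_le_iff₀ hσ] at hd1; exact hd1
    nlinarith [mul_pos hε hε]
  have h4 := mul_le_mul_of_nonneg_left h3 hΛ0.le
  have h5 := localization_expansion (y := y) (M := M) hΛ0 hd0 x z h g
  have h6 : M * (‖h‖ ^ 2 + ‖g‖ ^ 2) ≤ Λ * (σ / 2 * ε ^ 2) := by
    have hh2 : ‖h‖ ^ 2 ≤ ε ^ 2 := by gcongr
    have hg2 : ‖g‖ ^ 2 ≤ ε ^ 2 := by gcongr
    calc M * (‖h‖ ^ 2 + ‖g‖ ^ 2) ≤ M * (ε ^ 2 + ε ^ 2) := by gcongr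
      _ = 4 * M * (ε ^ 2 / 2) := by ring
      _ ≤ σ * Λ * (ε ^ 2 / 2) := by gcongr
      _ = _ := by ring
  have h7 : w * (K * ((ε ^ 2) ^ p / (R ^ 2) ^ p)) * θ ^ m ≤
      w * (K * ((ε ^ 2) ^ p / (R ^ 2) ^ p)) * θ ^ (min (level τ ε (x + h) (z + g)) m) := by
    have := hlev' (x + h) (z + g)
    gcongr
  have h8 : w * C / (R ^ 2) ^ p * (p * (d ^ 2) ^ (p - 1)) = Λ := by rw [hΛ]; ring
  rw [mul_add, ← mul_assoc _ (p * (d ^ 2) ^ (p - 1)), h8] at h2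
  have h9 : ∀ t : ℝ, w * (4 * t / R ^ 2) = M * t := by intro t; rw [hM]; ring
  have h10 : ∀ t : ℝ, w * (C * (t / (R ^ 2) ^ p)) = w * C / (R ^ 2) ^ p * t := by intro t; ring
  simp only [mul_add w, h9, h10]
  linarith

/-- At small distances the power is bounded by a multiple of `(ε / R) ^ (2p)`, and so is the change
of the localization, since it is of order `ε / R`. Only the level term is kept precisely. -/
theorem comparisonFun_near_le (hp : 0 < p) (hp2 : p ≤ 1 / 2) (hε : 0 < ε) (hR : 0 < R)
    (hεR : 2 * ε ≤ R) (hw : 0 < w) (hC0 : 0 < C) (hK : 0 < K)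
    (hm : 4 ≤ m) {x z X Z : Rn n}
    (hx : ‖x - y‖ < R / 2) (hz : ‖z - y‖ < R / 2) (hlev : level τ ε x z < m)
    (hX : X ∈ closedBall x ε) (hZ : Z ∈ closedBall z ε) {q : ℝ}
    (hq : q ≤ θ ^ (min (level τ ε X Z) m)) :
    comparisonFun p C K θ ε R w m τ y X Z ≤
      w * (4 * (‖x - y‖ ^ 2 + ‖z - y‖ ^ 2) / R ^ 2
        + (C * (m + 2) ^ 2 + 12) * (ε ^ 2 / R ^ 2) ^ p + K * (ε ^ 2 / R ^ 2) ^ p * (1 - q)) := by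
  have hd := norm_le_of_level_lt hε hlev hm
  rw [mem_closedBall, dist_eq_norm] at hX hZ
  have hm0 : (4 : ℝ) ≤ m := by exact_mod_cast hm
  have hXZ : ‖X - Z‖ ≤ (m + 2) * ε := by
    have : X - Z = (X - x) + (x - z) - (Z - z) := by abel
    rw [this]
    linarith [norm_sub_le ((X - x) + (x - z)) (Z - z), norm_add_le (X - x) (x - z)]
  have he : ε / R ≤ (ε ^ 2 / R ^ 2) ^ p := by
    rw [← div_pow]
    exact le_sq_rpow hp2 (by positivity) (by rw [div_le_one hR]; linarith)
  set e := (ε ^ 2 / R ^ 2) ^ p with hedef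
  have he0 : 0 < e := by positivity
  have h1 : (‖X - Z‖ ^ 2 / R ^ 2) ^ p ≤ (m + 2) ^ 2 * e := by
    calc (‖X - Z‖ ^ 2 / R ^ 2) ^ p ≤ (((m + 2) * ε) ^ 2 / R ^ 2) ^ p := by gcongr
      _ = (((m : ℝ) + 2) ^ 2) ^ p * e := by
        rw [mul_pow, mul_div_assoc, Real.mul_rpow (by positivity) (by positivity)]
      _ ≤ (((m : ℝ) + 2) ^ 2) ^ (1 : ℝ) * e := by
        gcongr
        · nlinarith
        · linarith
      _ = _ := by rw [Real.rpow_one]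
  have hloc : ∀ t s : Rn n, ‖t - y‖ < R / 2 → ‖s - t‖ ≤ ε →
      ‖s - y‖ ^ 2 ≤ ‖t - y‖ ^ 2 + 3 / 2 * (R * ε) := by
    intro t s ht hs
    have h2 : ‖s - y‖ ≤ ‖t - y‖ + ε := by
      have : s - y = (t - y) + (s - t) := by abel
      rw [this]
      linarith [norm_add_le (t - y) (s - t)]
    have h3 : ‖s - y‖ ^ 2 ≤ (‖t - y‖ + ε) ^ 2 := by gcongr
    nlinarith
  have h2 : 4 * (‖X - y‖ ^ 2 + ‖Z - y‖ ^ 2) / R ^ 2 ≤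
      4 * (‖x - y‖ ^ 2 + ‖z - y‖ ^ 2) / R ^ 2 + 12 * e := by
    have h3 : 4 * (‖X - y‖ ^ 2 + ‖Z - y‖ ^ 2) ≤ 4 * (‖x - y‖ ^ 2 + ‖z - y‖ ^ 2) + 12 * (R * ε) := by
      linarith [hloc x X hx hX, hloc z Z hz hZ]
    calc _ ≤ (4 * (‖x - y‖ ^ 2 + ‖z - y‖ ^ 2) + 12 * (R * ε)) / R ^ 2 := by gcongr
      _ = 4 * (‖x - y‖ ^ 2 + ‖z - y‖ ^ 2) / R ^ 2 + 12 * (ε / R) := by field_simp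
      _ ≤ _ := by gcongr
  unfold comparisonFun
  rw [← hedef]
  have h3 : C * (‖X - Z‖ ^ 2 / R ^ 2) ^ p ≤ C * ((m + 2) ^ 2 * e) := by gcongr
  have h4 : K * e * (1 - θ ^ (min (level τ ε X Z) m)) ≤ K * e * (1 - q) := by gcongr
  apply mul_le_mul_of_nonneg_left _ hw.le
  linarith

/-- The comparison function dominates the differences of `u`. -/
theorem sub_le_comparisonFun (hp : 0 < p) (hp2 : p ≤ 1 / 2) (hε : 0 < ε) (hR : 0 < R)
    (hεR : 2 * ε ≤ R) (hw : 0 < w) (hσ : 0 < σ) (hκ : 0 < κ) (hc : 0 < c) (hc1 : c ≤ 1)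
    (hC0 : 0 < C) (hC : 16 ≤ C * p * σ)
    (hm : 4 ≤ m) (hm0 : N ≤ ((m : ℝ) - 3) / 10) (hm1 : 6400 / σ ≤ ((m : ℝ) - 3) / 10)
    (hm2 : 16 ≤ ((m : ℝ) - 3) / 10) (hθ : θ = c / 2) (hK : C * (m + 2) ^ 2 + 13 ≤ K * θ ^ m)
    (hosc : ∀ x ∈ ball y R, ∀ z ∈ ball y R, u x - u z ≤ w)
    (hu : ∀ x ∈ ball y R, ∀ z ∈ ball y R, NearGain c ε τ u x z ∧ FarGain p N σ κ ε u x z) :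
    ∀ x ∈ ball y R, ∀ z ∈ ball y R, u x - u z ≤ comparisonFun p C K θ ε R w m τ y x z := by
  have hθ0 : 0 < θ := by rw [hθ]; positivity
  have hθ1 : θ < 1 := by rw [hθ]; linarith
  have hK0 : 0 < K := by
    have h1 : 0 < K * θ ^ m := lt_of_lt_of_le (by positivity) hK
    exact pos_of_mul_pos_left h1 (by positivity)
  have hnn : ∀ x z : Rn n, 0 ≤ 1 - θ ^ (min (level τ ε x z) m) := fun x z =>
    sub_nonneg.2 (pow_le_one₀ hθ0.le hθ1.le)
  set e := (ε ^ 2 / R ^ 2) ^ p with he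
  have he0 : 0 < e := by positivity
  have hη : 0 < min (w * e) (w * C * p / R ^ 2 * κ * ε ^ 2) := by
    apply lt_min <;> positivity
  have hF : ∀ x z : Rn n, 0 ≤ comparisonFun p C K θ ε R w m τ y x z := by
    intro x z
    have := hnn x z
    unfold comparisonFun
    positivity
  have hsub : ∀ x : Rn n, ‖x - y‖ < R / 2 → closedBall x ε ⊆ ball y R := by
    intro x hx
    apply closedBall_subset_ball'
    rw [dist_eq_norm]
    linarith
  refine le_of_excess_decrease hη hosc (fun x _ z _ => hF x z) ?_
  intro x hx z hz K₀ hK₀ hbd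
  -- Away from the centre the localization alone is at least `w`, because `4 * (R / 2) ^ 2 / R ^ 2 =
  -- 1`.
  have hout : R / 2 ≤ ‖x - y‖ ∨ R / 2 ≤ ‖z - y‖ → u x - u z ≤
      comparisonFun p C K θ ε R w m τ y x z + max (K₀ - min (w * e) (w * C * p / R ^ 2 * κ * ε ^ 2)) 0 := by
    intro hor
    have h1 : 1 ≤ 4 * (‖x - y‖ ^ 2 + ‖z - y‖ ^ 2) / R ^ 2 := by
      rw [one_le_div (by positivity)]
      rcases hor with h | h
      · nlinarith [sq_nonneg ‖z - y‖]
      · nlinarith [sq_nonneg ‖x - y‖]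
    have h2 : w ≤ comparisonFun p C K θ ε R w m τ y x z := by
      have := hnn x z
      unfold comparisonFun
      rw [← he]
      have h3 : 0 ≤ C * (‖x - z‖ ^ 2 / R ^ 2) ^ p := by positivity
      have h4 : 0 ≤ K * e * (1 - θ ^ (min (level τ ε x z) m)) := by positivity
      nlinarith
    linarith [hosc x hx z hz, le_max_right (K₀ - min (w * e) (w * C * p / R ^ 2 * κ * ε ^ 2)) 0]
  by_cases hxR : R / 2 ≤ ‖x - y‖
  · exact hout (Or.inl hxR)
  by_cases hzR : R / 2 ≤ ‖z - y‖
  · exact hout (Or.inr hzR)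
  by_cases hxz : x = z
  · rw [hxz, sub_self]
    exact add_nonneg (hF z z) (le_max_right _ _)
  rw [not_le] at hxR hzR
  refine le_trans ?_ (add_le_add_right (le_max_left _ _) _)
  rcases lt_or_ge (level τ ε x z) m with hlev | hlev
  · have hnear := (hu x hx z hz).1 hxz
    obtain ⟨i, hi⟩ : ∃ i, level τ ε x z = i + 1 :=
      ⟨level τ ε x z - 1, by have := level_pos (τ := τ) (ε := ε) hxz; omega⟩
    set base := K₀ + w * (4 * (‖x - y‖ ^ 2 + ‖z - y‖ ^ 2) / R ^ 2 + (C * (m + 2) ^ 2 + 12) * e)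
      with hbase
    -- A drop from level `i + 1` gains `θ ^ i` with probability `c = 2 * θ`, hence `2 * θ ^ (i + 1)`
    -- in the mean. One half makes up for the `θ ^ (i + 1)` already present in the comparison
    -- function at `(x, z)`; by `hK` the other half pays for the remaining terms and for the
    -- decrease `w * e`.
    have h1 := hnear (base + w * (K * e)) (w * (K * e) * θ ^ i) (by positivity) ?_ ?_
    · have h2 : θ ^ m ≤ θ ^ (i + 1) := pow_le_pow_of_le_one hθ0.le hθ1.le (by omega)
      have h3 : C * (m + 2) ^ 2 + 13 ≤ K * θ ^ (i + 1) :=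
        hK.trans (by gcongr)
      have h4 : w * e * (C * (m + 2) ^ 2 + 13) ≤ w * e * (K * θ ^ (i + 1)) := by gcongr
      have h5 : c * (w * (K * e) * θ ^ i) = 2 * (w * e * (K * θ ^ (i + 1))) := by
        rw [pow_succ, hθ]; ring
      have h6 : w * (4 * (‖x - y‖ ^ 2 + ‖z - y‖ ^ 2) / R ^ 2 + K * e * (1 - θ ^ (i + 1))) ≤
          comparisonFun p C K θ ε R w m τ y x z := by
        unfold comparisonFun
        rw [min_eq_left hlev.le, hi, ← he]
        have h3 : 0 ≤ C * (‖x - z‖ ^ 2 / R ^ 2) ^ p := by positivity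
        gcongr
        linarith
      have h7 := min_le_left (w * e) (w * C * p / R ^ 2 * κ * ε ^ 2)
      rw [h5] at h1
      linarith
    · intro X hX Z hZ
      have h2 := hbd X (hsub x hxR hX) Z (hsub z hzR hZ)
      have h3 := comparisonFun_near_le (q := 0) hp hp2 hε hR hεR hw hC0 hK0 hm hxR hzR hlev hX hZ
        (θ := θ) (by positivity)
      rw [← he] at h3
      linarith
    · intro X hX Z hZ hXZ
      have h2 := hbd X (hsub x hxR hX) Z (hsub z hzR hZ)
      have h3 := comparisonFun_near_le (q := θ ^ i) hp hp2 hε hR hεR hw hC0 hK0 hm hxR hzR hlev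
        hX hZ (θ := θ) (pow_le_pow_of_le_one hθ0.le hθ1.le
          ((min_le_left _ _).trans (by omega)))
      rw [← he] at h3
      linarith
  · obtain ⟨Λ, v, a, b, hΛ, hv, ha, hb, hinc⟩ := comparisonFun_far_le hp hp2 hε hR hw hσ hC0 hC hK0
      hθ0 hθ1 hm hm1 hm2 hxR hzR hlev
    have hΛ0 : 0 < Λ := lt_of_lt_of_le (by positivity) hΛ
    have h1 := (hu x hx z hz).2 (comparisonFun p C K θ ε R w m τ y x z + K₀) Λ ‖x - z‖ v a b hΛ0
      (le_trans (by gcongr) (le_norm_of_le_level hε hlev hm)) hv ha hb ?_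
    · have h2 : w * C * p / R ^ 2 * κ * ε ^ 2 ≤ Λ * κ * ε ^ 2 := by gcongr
      have h7 := min_le_right (w * e) (w * C * p / R ^ 2 * κ * ε ^ 2)
      linarith
    · intro h g hh hg
      have h2 := hbd (x + h) (hsub x hxR (by simpa using hh)) (z + g) (hsub z hzR (by simpa using hg))
      linarith [hinc h g hh hg]

end Comparison

theorem sub_le_oscOn {n : ℕ} {u : Rn n → ℝ} (hu : ∃ K : ℝ, ∀ y, |u y| ≤ K) {S : Set (Rn n)}
    {x z : Rn n} (hx : x ∈ S) (hz : z ∈ S) : u x - u z ≤ oscOn u S := by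
  obtain ⟨K, hK⟩ := hu
  apply le_csSup
  · refine ⟨2 * K, ?_⟩
    rintro _ ⟨⟨a, b⟩, _, rfl⟩
    have h1 := abs_le.1 (hK a)
    have h2 := abs_le.1 (hK b)
    simp only
    linarith
  · exact ⟨(x, z), ⟨hx, hz⟩, rfl⟩

/-- A function for which couplings with a gain exist at small and at large distances satisfies the
asymptotic Hölder estimate. -/
theorem exists_asymptoticHolder {n : ℕ} {p c N σ κ : ℝ} (hp : 0 < p) (hp2 : p ≤ 1 / 2)
    (hc : 0 < c) (hc1 : c ≤ 1) (hσ : 0 < σ) (hκ : 0 < κ) :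
    ∃ C C' : ℝ, 0 < C ∧ 0 < C' ∧ ∀ (ε R : ℝ) (x₀ : Rn n) (u : Rn n → ℝ) (τ : Rn n → Prop),
      0 < ε → 0 < R → (∃ K : ℝ, ∀ y, |u y| ≤ K) →
      (∀ x ∈ ball x₀ (2 * R), ∀ z ∈ ball x₀ (2 * R),
        NearGain c ε τ u x z ∧ FarGain p N σ κ ε u x z) →
      AsymptoticHolder (2 * p) C C' ε u x₀ R := by
  -- Level at least `m` must imply all distance requirements of the far estimates; the form `10 * _
  -- + 3` inverts `le_norm_of_le_level`.
  obtain ⟨m, hm⟩ := exists_nat_ge (10 * (max N (max (6400 / σ) 16)) + 3)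
  have hmN : max N (max (6400 / σ) 16) ≤ ((m : ℝ) - 3) / 10 := by linarith
  have hm0 := (le_max_left N (max (6400 / σ) 16)).trans hmN
  have hm1 := ((le_max_left (6400 / σ) 16).trans (le_max_right N _)).trans hmN
  have hm2 := ((le_max_right (6400 / σ) 16).trans (le_max_right N _)).trans hmN
  have hm4 : 4 ≤ m := by
    have : (4 : ℝ) ≤ m := by linarith
    exact_mod_cast this
  set C := 16 / (p * σ) with hCdef
  have hC0 : 0 < C := by positivity
  have hC : 16 ≤ C * p * σ := by rw [hCdef]; field_simp; norm_num
  set K := (C * (m + 2) ^ 2 + 13) / (c / 2) ^ m with hKdef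
  have hK0 : 0 < K := by positivity
  have hK : C * (m + 2) ^ 2 + 13 ≤ K * (c / 2) ^ m := by
    rw [hKdef, div_mul_cancel₀ _ (by positivity)]
  -- The `4` accounts for the localization term; it and the `2` also cover the trivial cases `R / 2
  -- ≤ ‖x - z‖` and `R / 2 ≤ ε`.
  refine ⟨C + 4, K + 2, by positivity, by positivity, ?_⟩
  intro ε R x₀ u τ hε hR hbdd hu
  set w := oscOn u (ball x₀ (2 * R)) with hw
  have hosc : ∀ x ∈ ball x₀ (2 * R), ∀ z ∈ ball x₀ (2 * R), u x - u z ≤ w :=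
    fun x hx z hz => sub_le_oscOn hbdd hx hz
  have hmono : ball x₀ R ⊆ ball x₀ (2 * R) := ball_subset_ball (by linarith)
  have hw0 : 0 ≤ w := by
    have h1 := hosc x₀ (mem_ball_self (by positivity)) x₀ (mem_ball_self (by positivity))
    linarith
  have hpow : ∀ t : ℝ, 0 ≤ t → (t ^ 2 / R ^ 2) ^ p = t ^ (2 * p) / R ^ (2 * p) := by
    intro t ht
    rw [Real.div_rpow (by positivity) (by positivity), ← Real.rpow_natCast, ← Real.rpow_natCast,
      ← Real.rpow_mul ht, ← Real.rpow_mul hR.le]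
    norm_num
  have hhalf : ∀ t : ℝ, R / 2 ≤ t → 1 ≤ 2 * (t ^ (2 * p) / R ^ (2 * p)) := by
    intro t ht
    have h1 : 1 / 2 ≤ ((1 / 2 : ℝ) ^ 2) ^ p := le_sq_rpow hp2 (by norm_num) (by norm_num)
    rw [← hpow t (by linarith)]
    have h2 : ((1 / 2 : ℝ) ^ 2) ^ p ≤ (t ^ 2 / R ^ 2) ^ p := by
      rw [← div_pow]
      have h3 : 1 / 2 ≤ t / R := by
        rw [le_div_iff₀ hR]
        linarith
      gcongr
    linarith
  have main : ∀ x ∈ ball x₀ R, ∀ z ∈ ball x₀ R, u x - u z ≤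
      (C + 4) * w * (‖x - z‖ ^ (2 * p) / R ^ (2 * p)) + (K + 2) * w * (ε ^ (2 * p) / R ^ (2 * p)) := by
    intro x hx z hz
    set D := ‖x - z‖ ^ (2 * p) / R ^ (2 * p) with hD
    set e := ε ^ (2 * p) / R ^ (2 * p) with he
    have hD0 : 0 ≤ D := by positivity
    have he0 : 0 ≤ e := by positivity
    have hw1 := hosc x (hmono hx) z (hmono hz)
    have hA : 0 ≤ C * w * D := by positivity
    have hB : 0 ≤ K * w * e := by positivity
    have hwD : 0 ≤ w * D := by positivity
    have hwe : 0 ≤ w * e := by positivity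
    rcases le_or_gt (R / 2) ‖x - z‖ with h1 | h1
    · have h2 := hhalf _ h1
      rw [← hD] at h2
      nlinarith
    rcases le_or_gt (R / 2) ε with h3 | h3
    · have h2 := hhalf _ h3
      rw [← he] at h2
      nlinarith
    rcases hw0.eq_or_lt with h4 | h4
    · rw [← h4] at hw1 ⊢
      linarith
    have hball : ball x R ⊆ ball x₀ (2 * R) := by
      apply ball_subset_ball'
      rw [mem_ball] at hx
      linarith
    -- Centring the localization at `x` itself leaves only `4 * ‖x - z‖ ^ 2 / R ^ 2` of it, which
    -- the Hölder term dominates.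
    have h5 := sub_le_comparisonFun (y := x) hp hp2 hε hR (by linarith) h4 hσ hκ hc hc1 hC0 hC
      hm4 hm0 hm1 hm2 rfl hK (fun a ha b hb => hosc a (hball ha) b (hball hb))
      (fun a ha b hb => hu a (hball ha) b (hball hb)) x (mem_ball_self hR) z
      (by rw [mem_ball, dist_eq_norm, norm_sub_rev]; linarith)
    unfold comparisonFun at h5
    rw [hpow _ (norm_nonneg _), hpow _ hε.le, ← hD, ← he, sub_self, norm_zero, norm_sub_rev z x] at h5
    have h6 : ‖x - z‖ ^ 2 / R ^ 2 ≤ D := by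
      rcases (norm_nonneg (x - z)).eq_or_lt with h7 | h7
      · rw [← h7]; simpa using hD0
      · have h8 : ‖x - z‖ / R ≤ 1 := by rw [div_le_one hR]; linarith
        have h9 := le_sq_rpow hp2 (by positivity) h8
        rw [div_pow, hpow _ (norm_nonneg _), ← hD] at h9
        rw [← div_pow]
        nlinarith [div_nonneg h7.le hR.le]
    have h10 : K * e * (1 - (c / 2) ^ (min (level τ ε x z) m)) ≤ K * e * 1 := by
      gcongr
      have : 0 < (c / 2) ^ (min (level τ ε x z) m) := by positivity
      linarith
    have h11 : w * (C * D + 4 * (0 ^ 2 + ‖x - z‖ ^ 2) / R ^ 2 +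
        K * e * (1 - (c / 2) ^ (min (level τ ε x z) m))) ≤ w * (C * D + 4 * D + K * e * 1) := by
      gcongr
      have : 4 * (0 ^ 2 + ‖x - z‖ ^ 2) / R ^ 2 = 4 * (‖x - z‖ ^ 2 / R ^ 2) := by ring
      rw [this]
      gcongr
    linarith
  intro x hx z hz
  rw [abs_le]
  have h1 := main x hx z hz
  have h2 := main z hz x hx
  rw [norm_sub_rev z x] at h2
  constructor <;> linarith

/-! ### Averages and the dynamic programming equation -/

theorem integrable_of_abs_le {α : Type*} [MeasurableSpace α] {μ : Measure α} [IsFiniteMeasure μ]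
    {f : α → ℝ} {K : ℝ} (hf : Measurable f) (hK : ∀ y, |f y| ≤ K) : Integrable f μ :=
  Integrable.of_bound hf.aestronglyMeasurable K (Filter.Eventually.of_forall hK)

theorem abs_integral_le_of_abs_le {α : Type*} [MeasurableSpace α] {μ : Measure α}
    [IsProbabilityMeasure μ] {f : α → ℝ} {K : ℝ} (hK : ∀ y, |f y| ≤ K) : |∫ y, f y ∂μ| ≤ K := by
  have h := norm_integral_le_of_norm_le_const (μ := μ) (f := f) (C := K)
    (Filter.Eventually.of_forall hK)
  simpa using h

/-- An average of a function that is at most `T`, and at most `T - s` on a set of probability at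
least `q`. -/
theorem integral_le_sub_mul {α : Type*} [MeasurableSpace α] {μ : Measure α}
    [IsProbabilityMeasure μ] {f : α → ℝ} {S : Set α} {T s q : ℝ} (hf : Integrable f μ)
    (hS : MeasurableSet S) (hs : 0 ≤ s) (hq : q ≤ μ.real S) (hT : ∀ᵐ y ∂μ, f y ≤ T)
    (hTs : ∀ᵐ y ∂μ, y ∈ S → f y ≤ T - s) : ∫ y, f y ∂μ ≤ T - q * s := by
  have h1 : ∫ y, f y ∂μ ≤ ∫ y, (T - S.indicator (fun _ => s) y) ∂μ := by
    apply integral_mono_ae hf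
    · exact (integrable_const T).sub ((integrable_const s).indicator hS)
    · filter_upwards [hT, hTs] with y hy hys
      by_cases h : y ∈ S
      · simpa [h] using hys h
      · simpa [h] using hy
  rw [integral_sub (integrable_const T) ((integrable_const s).indicator hS),
    integral_indicator_const _ hS] at h1
  simp only [integral_const, probReal_univ, smul_eq_mul, one_mul] at h1
  nlinarith

theorem integral_sub_integral_le {α : Type*} [MeasurableSpace α] {μ ν : Measure α}
    [IsProbabilityMeasure μ] [IsProbabilityMeasure ν] {f : α → ℝ} {T : ℝ} (hf : Integrable f μ)
    (hf' : Integrable f ν) {A B : Set α} (hA : ∀ᵐ y ∂μ, y ∈ A) (hB : ∀ᵐ y ∂ν, y ∈ B)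
    (h : ∀ a ∈ A, ∀ b ∈ B, f a - f b ≤ T) : ∫ y, f y ∂μ - ∫ y, f y ∂ν ≤ T := by
  have h1 : ∀ b ∈ B, ∫ y, f y ∂μ ≤ T + f b := by
    intro b hb
    have := integral_mono_ae hf (integrable_const (T + f b)) (by
      filter_upwards [hA] with a ha
      linarith [h a ha b hb])
    simpa using this
  have h2 : ∫ y, f y ∂μ - T ≤ ∫ y, f y ∂ν := by
    have := integral_mono_ae (integrable_const (∫ y, f y ∂μ - T)) hf' (by
      filter_upwards [hB] with b hb
      linarith [h1 b hb])
    simpa using this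
  linarith

section DPP

variable {n : ℕ} {A : Rn n → Set (Measure (Rn n))} {Ω : Set (Rn n)} {u : Rn n → ℝ}

/-- To bound `u x - u z`, it suffices to answer each choice of measures with a further choice. -/
theorem SatisfiesDPP.sub_le (hu : SatisfiesDPP A A Ω u) {K : ℝ} (hK : ∀ y, |u y| ≤ K) {x z : Rn n}
    (hx : x ∈ Ω) (hz : z ∈ Ω) (hne : ∀ y, (A y).Nonempty)
    (hprob : ∀ y ∈ Ω, ∀ μ ∈ A y, IsProbabilityMeasure μ) {T : ℝ}
    (h : ∀ μ ∈ A x, ∀ ν ∈ A z, ∃ μ' ∈ A x, ∃ ν' ∈ A z,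
      (∫ y, u y ∂μ - ∫ y, u y ∂ν) + (∫ y, u y ∂μ' - ∫ y, u y ∂ν') ≤ 2 * T) :
    u x - u z ≤ T := by
  set I : Measure (Rn n) → ℝ := fun μ => ∫ y, u y ∂μ with hI
  have habove : ∀ y ∈ Ω, BddAbove (I '' A y) := by
    rintro y hy
    refine ⟨K, ?_⟩
    rintro _ ⟨μ, hμ, rfl⟩
    have := hprob y hy μ hμ
    exact (abs_le.1 (abs_integral_le_of_abs_le hK)).2
  have hbelow : ∀ y ∈ Ω, BddBelow (I '' A y) := by
    rintro y hy
    refine ⟨-K, ?_⟩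
    rintro _ ⟨μ, hμ, rfl⟩
    have := hprob y hy μ hμ
    exact (abs_le.1 (abs_integral_le_of_abs_le hK)).1
  rw [hu x hx, hu z hz]
  apply le_of_forall_pos_le_add
  intro η hη
  obtain ⟨_, ⟨μ, hμ, rfl⟩, h1⟩ := exists_lt_of_lt_csSup ((hne x).image I)
    (show sSup (I '' A x) - η < sSup (I '' A x) by linarith)
  obtain ⟨_, ⟨ν, hν, rfl⟩, h2⟩ := exists_lt_of_csInf_lt ((hne z).image I)
    (show sInf (I '' A z) < sInf (I '' A z) + η by linarith)
  -- The answers bound the infimum at `x` from above and the supremum at `z` from below.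
  obtain ⟨μ', hμ', ν', hν', h3⟩ := h μ hμ ν hν
  have h4 := csInf_le (hbelow x hx) ⟨μ', hμ', rfl⟩
  have h5 := le_csSup (habove z hz) ⟨ν', hν', rfl⟩
  simp only [hI] at *
  linarith

theorem integral_mix {a K : ℝ} (ha : 0 ≤ a) (ha1 : a ≤ 1) (hm : Measurable u)
    (hK : ∀ y, |u y| ≤ K) (y : Rn n) (μ : Measure (Rn n)) [IsProbabilityMeasure μ] :
    ∫ w, u w ∂(ENNReal.ofReal a • Measure.dirac y + ENNReal.ofReal (1 - a) • μ) =
      a * u y + (1 - a) * ∫ w, u w ∂μ := by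
  rw [integral_add_measure, integral_smul_measure, integral_smul_measure, integral_dirac,
    ENNReal.toReal_ofReal ha, ENNReal.toReal_ofReal (by linarith), smul_eq_mul, smul_eq_mul]
  · exact (integrable_of_abs_le hm hK).smul_measure ENNReal.ofReal_ne_top
  · exact (integrable_of_abs_le hm hK).smul_measure ENNReal.ofReal_ne_top

theorem isProbabilityMeasure_mix {a : ℝ} (ha : 0 ≤ a) (ha1 : a ≤ 1) (y : Rn n)
    (μ : Measure (Rn n)) [IsProbabilityMeasure μ] : IsProbabilityMeasure
      (ENNReal.ofReal a • Measure.dirac y + ENNReal.ofReal (1 - a) • μ) := by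
  constructor
  simp only [Measure.coe_add, Measure.coe_smul, Pi.add_apply, Pi.smul_apply, measure_univ,
    smul_eq_mul, mul_one]
  rw [← ENNReal.ofReal_add ha (by linarith)]
  simp

end DPP

/-! ### Couplings of uniform distributions on balls -/

section Ball

variable {n : ℕ} {ε : ℝ} {u : Rn n → ℝ}

theorem isProbabilityMeasure_uniformBall (hε : 0 < ε) (x : Rn n) :
    IsProbabilityMeasure (uniformBall x ε) := by
  constructor
  simp only [uniformBall, Measure.smul_apply, Measure.restrict_apply_univ, smul_eq_mul]
  exact ENNReal.inv_mul_cancel (measure_ball_pos _ _ hε).ne' measure_ball_lt_top.ne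

theorem ae_uniformBall_mem (x : Rn n) : ∀ᵐ y ∂(uniformBall x ε), y ∈ ball x ε :=
  Measure.ae_smul_measure (ae_restrict_mem measurableSet_ball) _

/-- Uniform sampling from a ball, parametrized by the ball around the origin. -/
theorem integral_uniformBall (x : Rn n) (e : Rn n ≃ₗᵢ[ℝ] Rn n) :
    ∫ y, u y ∂(uniformBall x ε) = ∫ w, u (x + e w) ∂(uniformBall 0 ε) := by
  have hvol : volume (ball x ε) = volume (ball (0 : Rn n) ε) := by
    rw [Measure.addHaar_ball_center]
  simp only [uniformBall, integral_smul_measure, hvol]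
  congr 1
  have hmp : MeasurePreserving (fun w : Rn n => x + e w) volume volume :=
    (measurePreserving_add_left volume x).comp e.measurePreserving
  have hemb : MeasurableEmbedding (fun w : Rn n => x + e w) :=
    (Homeomorph.addLeft x).measurableEmbedding.comp e.toHomeomorph.measurableEmbedding
  have hpre : (fun w : Rn n => x + e w) ⁻¹' ball x ε = ball 0 ε := by
    ext w
    simp [mem_ball, dist_eq_norm]
  rw [← hpre, hmp.setIntegral_preimage_emb hemb]

theorem uniformBall_real_ball (hε : 0 < ε) {r : ℝ} (hr : 0 < r) {q : Rn n}
    (hq : ‖q‖ + r * ε ≤ ε) : (uniformBall 0 ε).real (ball q (r * ε)) = r ^ n := by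
  have hsub : ball q (r * ε) ⊆ ball (0 : Rn n) ε := ball_subset_ball' (by simpa [add_comm] using hq)
  have hfr : Module.finrank ℝ (Rn n) = n := by simp
  rw [measureReal_def, uniformBall, Measure.smul_apply, Measure.restrict_apply measurableSet_ball,
    inter_eq_left.2 hsub, smul_eq_mul, Measure.addHaar_ball_mul_of_pos _ _ hr, hfr,
    mul_left_comm,
    ENNReal.inv_mul_cancel (measure_ball_pos _ _ hε).ne' measure_ball_lt_top.ne, mul_one,
    ENNReal.toReal_ofReal (by positivity)]

/-- Averages over two overlapping balls: the next positions coincide with probability at least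
`4⁻ⁿ`. -/
theorem uniformBall_sub_le_of_overlap (hε : 0 < ε) {K : ℝ} (hm : Measurable u)
    (hK : ∀ y, |u y| ≤ K) {x z : Rn n} (hxz : ‖x - z‖ ≤ 3 / 2 * ε) {T s : ℝ} (hs : s ≤ T)
    (hs0 : 0 ≤ s) (h : ∀ X ∈ ball x ε, ∀ Z ∈ ball z ε, u X - u Z ≤ T) :
    ∫ y, u y ∂(uniformBall x ε) - ∫ y, u y ∂(uniformBall z ε) ≤ T - (1 / 4) ^ n * s := by
  set B := ball x ε
  set B' := ball z ε
  have hB : MeasurableSet B := measurableSet_ball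
  have hB' : MeasurableSet B' := measurableSet_ball
  set V := volume.real B with hV
  have hVz : volume.real B' = V := by
    rw [hV, measureReal_def, measureReal_def, Measure.addHaar_ball_center volume z,
      Measure.addHaar_ball_center volume x]
  have hV0 : 0 < V := ENNReal.toReal_pos (measure_ball_pos _ _ hε).ne' measure_ball_lt_top.ne
  have hint : ∀ S : Set (Rn n), S ⊆ B ∨ S ⊆ B' → IntegrableOn u S := by
    intro S hS
    have hfin : volume S < ∞ := by
      rcases hS with hS | hS
      · exact (measure_mono hS).trans_lt measure_ball_lt_top
      · exact (measure_mono hS).trans_lt measure_ball_lt_top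
    have : IsFiniteMeasure (volume.restrict S) := ⟨by simpa using hfin⟩
    exact integrable_of_abs_le hm hK
  have h1 : ∀ w : Rn n, volume.real (ball w ε) = V → ∫ y, u y ∂(uniformBall w ε) =
      V⁻¹ * ∫ y in ball w ε, u y := by
    intro w hw
    rw [uniformBall, integral_smul_measure, ENNReal.toReal_inv, ← measureReal_def, hw, smul_eq_mul]
  rw [h1 x rfl, h1 z hVz]
  have h2 : (∫ y in B, u y) = (∫ y in B ∩ B', u y) + (∫ y in B \ B', u y) :=
    (integral_inter_add_sdiff hB' (hint B (Or.inl subset_rfl))).symm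
  have h3 : (∫ y in B', u y) = (∫ y in B ∩ B', u y) + (∫ y in B' \ B, u y) := by
    rw [inter_comm]
    exact (integral_inter_add_sdiff hB (hint B' (Or.inr subset_rfl))).symm
  -- Outside the overlap the balls are coupled by the point reflection in the midpoint of `x` and
  -- `z`.
  have hmp : MeasurePreserving (fun y : Rn n => x + z - y) volume volume :=
    Measure.measurePreserving_sub_left volume (x + z)
  have hemb : MeasurableEmbedding (fun y : Rn n => x + z - y) :=
    (Homeomorph.subLeft (x + z)).measurableEmbedding
  have hpre : (fun y : Rn n => x + z - y) ⁻¹' (B' \ B) = B \ B' := by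
    ext y
    simp only [mem_preimage, mem_sdiff, B, B', mem_ball, dist_eq_norm]
    have e1 : x + z - y - z = -(y - x) := by abel
    have e2 : x + z - y - x = -(y - z) := by abel
    rw [e1, e2, norm_neg, norm_neg]
  have h4 : (∫ y in B' \ B, u y) = (∫ y in B \ B', u (x + z - y)) := by
    rw [← hpre, hmp.setIntegral_preimage_emb hemb]
  have hint' : IntegrableOn (fun y => u (x + z - y)) (B \ B') := by
    have : IsFiniteMeasure (volume.restrict (B \ B')) :=
      ⟨by simpa using (measure_mono sdiff_subset).trans_lt (measure_ball_lt_top (x := x) (r := ε))⟩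
    exact integrable_of_abs_le (hm.comp (measurable_const.sub measurable_id)) (fun y => hK _)
  have h5 : (∫ y in B \ B', u y) - (∫ y in B \ B', u (x + z - y)) ≤ T * volume.real (B \ B') := by
    rw [← integral_sub (hint _ (Or.inl sdiff_subset)) hint']
    have hfin : volume (B \ B') ≠ ∞ := ((measure_mono sdiff_subset).trans_lt measure_ball_lt_top).ne
    have : ∫ _ in B \ B', T = T * volume.real (B \ B') := by
      rw [setIntegral_const, smul_eq_mul, mul_comm]
    rw [← this]
    apply setIntegral_mono_on ((hint _ (Or.inl sdiff_subset)).sub hint') _ (hB.diff hB')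
    · intro y hy
      rw [← hpre] at hy
      have hyB : y ∈ B := by rw [hpre] at hy; exact hy.1
      exact h y hyB _ hy.1
    · exact integrableOn_const hfin
  have h6 : (1 / 4) ^ n * V ≤ volume.real (B ∩ B') := by
    have hsub : ball ((1 / 2 : ℝ) • (x + z)) (1 / 4 * ε) ⊆ B ∩ B' := by
      apply subset_inter
      · apply ball_subset_ball'
        rw [dist_eq_norm]
        have : (1 / 2 : ℝ) • (x + z) - x = (-(1 / 2) : ℝ) • (x - z) := by module
        rw [this, norm_smul]
        norm_num
        linarith
      · apply ball_subset_ball'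
        rw [dist_eq_norm]
        have : (1 / 2 : ℝ) • (x + z) - z = (1 / 2 : ℝ) • (x - z) := by module
        rw [this, norm_smul]
        norm_num
        linarith
    have hfin : volume (B ∩ B') ≠ ∞ :=
      ((measure_mono inter_subset_left).trans_lt measure_ball_lt_top).ne
    refine le_trans (le_of_eq ?_) (measureReal_mono hsub hfin)
    have hfr : Module.finrank ℝ (Rn n) = n := by simp
    rw [hV, measureReal_def, measureReal_def, Measure.addHaar_ball_mul_of_pos _ _ (by norm_num), hfr,
      Measure.addHaar_ball_center volume x, ENNReal.toReal_mul, ENNReal.toReal_ofReal (by positivity)]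
  have h7 : volume.real (B \ B') = V - volume.real (B ∩ B') := by
    have := measureReal_inter_add_sdiff (μ := volume) (s := B) hB' measure_ball_lt_top.ne
    linarith
  have hT : 0 ≤ T := hs0.trans hs
  have h8 : (∫ y in B, u y) - (∫ y in B', u y) ≤ V * (T - (1 / 4) ^ n * s) := by
    rw [h2, h3, h4]
    have h9 : T * volume.real (B \ B') ≤ T * (V - (1 / 4) ^ n * V) := by
      rw [h7]; gcongr
    -- On the overlap the difference vanishes, and `s ≤ T` makes this a gain of at least `s`.
    have h10 : (1 / 4 : ℝ) ^ n * V * s ≤ (1 / 4) ^ n * V * T := by gcongr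
    linarith
  rw [← mul_sub, inv_mul_le_iff₀ hV0]
  exact h8

end Ball

section Average

variable {n : ℕ} {ε : ℝ} {u : Rn n → ℝ}

/-- The increment `w` at `x` is coupled with `e w` at `z`; the gain occurs on a ball of relative
volume `r ^ n`. -/
theorem uniformBall_sub_le (hε : 0 < ε) {K : ℝ} (hm : Measurable u) (hK : ∀ y, |u y| ≤ K)
    {x z : Rn n} (e : Rn n ≃ₗᵢ[ℝ] Rn n) {T s r : ℝ} {q : Rn n} (hs : 0 ≤ s) (hr : 0 < r)
    (hq : ‖q‖ + r * ε ≤ ε) (hT : ∀ w : Rn n, ‖w‖ < ε → u (x + w) - u (z + e w) ≤ T)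
    (hTs : ∀ w : Rn n, ‖w - q‖ < r * ε → u (x + w) - u (z + e w) ≤ T - s) :
    ∫ y, u y ∂(uniformBall x ε) - ∫ y, u y ∂(uniformBall z ε) ≤ T - r ^ n * s := by
  have := isProbabilityMeasure_uniformBall hε (0 : Rn n)
  have h1 : ∀ (y : Rn n) (e : Rn n ≃ₗᵢ[ℝ] Rn n),
      Integrable (fun w => u (y + e w)) (uniformBall 0 ε) := fun y e =>
    integrable_of_abs_le (hm.comp (measurable_const.add e.continuous.measurable)) (fun w => hK _)
  have h2 := h1 x (LinearIsometryEquiv.refl ℝ _)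
  rw [integral_uniformBall x (LinearIsometryEquiv.refl ℝ _), integral_uniformBall z e,
    ← integral_sub h2 (h1 z e)]
  refine integral_le_sub_mul (S := ball q (r * ε)) (h2.sub (h1 z e)) measurableSet_ball hs
    (uniformBall_real_ball hε hr hq).ge ?_ ?_
  · filter_upwards [ae_uniformBall_mem 0] with w hw
    exact hT w (by simpa using hw)
  · exact Filter.Eventually.of_forall fun w hw => hTs w (by simpa [dist_eq_norm] using hw)

/-- A coupling by a linear isometry, in which the increments `w` and `-w` are taken together. -/
theorem uniformBall_sub_le_symm (hε : 0 < ε) {K : ℝ} (hm : Measurable u) (hK : ∀ y, |u y| ≤ K)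
    {x z : Rn n} (e : Rn n ≃ₗᵢ[ℝ] Rn n) {T s r : ℝ} {q : Rn n} (hs : 0 ≤ s) (hr : 0 < r)
    (hq : ‖q‖ + r * ε ≤ ε)
    (hT : ∀ w : Rn n, ‖w‖ < ε →
      (u (x + w) - u (z + e w)) + (u (x + -w) - u (z + e (-w))) ≤ 2 * T)
    (hTs : ∀ w : Rn n, ‖w - q‖ < r * ε →
      (u (x + w) - u (z + e w)) + (u (x + -w) - u (z + e (-w))) ≤ 2 * (T - s)) :
    ∫ y, u y ∂(uniformBall x ε) - ∫ y, u y ∂(uniformBall z ε) ≤ T - r ^ n * s := by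
  have := isProbabilityMeasure_uniformBall hε (0 : Rn n)
  have h1 : ∀ (y : Rn n) (e : Rn n ≃ₗᵢ[ℝ] Rn n),
      Integrable (fun w => u (y + e w)) (uniformBall 0 ε) := fun y e =>
    integrable_of_abs_le (hm.comp (measurable_const.add e.continuous.measurable)) (fun w => hK _)
  have e1 := integral_uniformBall (u := u) (ε := ε) x (LinearIsometryEquiv.refl ℝ _)
  have e2 := integral_uniformBall (u := u) (ε := ε) z e
  have e3 := integral_uniformBall (u := u) (ε := ε) x (LinearIsometryEquiv.neg ℝ)
  have e4 := integral_uniformBall (u := u) (ε := ε) z ((LinearIsometryEquiv.neg ℝ).trans e)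
  have i1 := h1 x (LinearIsometryEquiv.refl ℝ _)
  have i2 := h1 z e
  have i3 := h1 x (LinearIsometryEquiv.neg ℝ)
  have i4 := h1 z ((LinearIsometryEquiv.neg ℝ).trans e)
  have key : ∫ w, ((u (x + w) - u (z + e w)) + (u (x + -w) - u (z + e (-w)))) ∂(uniformBall 0 ε) ≤
      2 * T - r ^ n * (2 * s) := by
    refine integral_le_sub_mul (S := ball q (r * ε)) ((i1.sub i2).add (i3.sub i4))
      measurableSet_ball (by positivity) (uniformBall_real_ball hε hr hq).ge ?_ ?_
    · filter_upwards [ae_uniformBall_mem 0] with w hw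
      exact hT w (by simpa using hw)
    · refine Filter.Eventually.of_forall fun w hw => ?_
      rw [← mul_sub]
      exact hTs w (by simpa [dist_eq_norm] using hw)
  have h5 : ∫ w, ((u (x + w) - u (z + e w)) + (u (x + -w) - u (z + e (-w)))) ∂(uniformBall 0 ε) =
      ((∫ y, u y ∂(uniformBall x ε)) - (∫ y, u y ∂(uniformBall z ε))) +
      ((∫ y, u y ∂(uniformBall x ε)) - (∫ y, u y ∂(uniformBall z ε))) := by
    nth_rw 1 [e1, e2]
    rw [e3, e4, ← integral_sub i1 i2, ← integral_sub i3 i4]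
    exact integral_add (i1.sub i2) (i3.sub i4)
  rw [h5] at key
  linarith

/-- Comparison of a fixed point with an average over a ball, symmetrized. -/
theorem two_mul_sub_uniformBall_le_symm (hε : 0 < ε) {K : ℝ} (hm : Measurable u)
    (hK : ∀ y, |u y| ≤ K) {z : Rn n} {A T s r : ℝ} {q : Rn n} (hs : 0 ≤ s) (hr : 0 < r)
    (hq : ‖q‖ + r * ε ≤ ε) (hT : ∀ w : Rn n, ‖w‖ < ε → A - u (z + w) - u (z + -w) ≤ 2 * T)
    (hTs : ∀ w : Rn n, ‖w - q‖ < r * ε → A - u (z + w) - u (z + -w) ≤ 2 * (T - s)) :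
    A - 2 * ∫ y, u y ∂(uniformBall z ε) ≤ 2 * (T - r ^ n * s) := by
  have := isProbabilityMeasure_uniformBall hε (0 : Rn n)
  have h1 : ∀ (y : Rn n) (e : Rn n ≃ₗᵢ[ℝ] Rn n),
      Integrable (fun w => u (y + e w)) (uniformBall 0 ε) := fun y e =>
    integrable_of_abs_le (hm.comp (measurable_const.add e.continuous.measurable)) (fun w => hK _)
  have e1 := integral_uniformBall (u := u) (ε := ε) z (LinearIsometryEquiv.refl ℝ _)
  have e2 := integral_uniformBall (u := u) (ε := ε) z (LinearIsometryEquiv.neg ℝ)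
  have i1 := h1 z (LinearIsometryEquiv.refl ℝ _)
  have i2 := h1 z (LinearIsometryEquiv.neg ℝ)
  have i0 : Integrable (fun _ : Rn n => A) (uniformBall 0 ε) := integrable_const A
  have key : ∫ w, (A - u (z + w) - u (z + -w)) ∂(uniformBall 0 ε) ≤ 2 * T - r ^ n * (2 * s) := by
    refine integral_le_sub_mul (S := ball q (r * ε)) ((i0.sub i1).sub i2)
      measurableSet_ball (by positivity) (uniformBall_real_ball hε hr hq).ge ?_ ?_
    · filter_upwards [ae_uniformBall_mem 0] with w hw
      exact hT w (by simpa using hw)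
    · refine Filter.Eventually.of_forall fun w hw => ?_
      rw [← mul_sub]
      exact hTs w (by simpa [dist_eq_norm] using hw)
  have h5 : ∫ w, (A - u (z + w) - u (z + -w)) ∂(uniformBall 0 ε) =
      A - (∫ y, u y ∂(uniformBall z ε)) - (∫ y, u y ∂(uniformBall z ε)) := by
    nth_rw 1 [e1]
    rw [e2]
    have h6 := integral_sub (i0.sub i1) i2
    have h7 := integral_sub i0 i1
    have h8 : ∫ _, A ∂(uniformBall (0 : Rn n) ε) = A := by simp
    rw [h8] at h7
    rw [← h7]
    exact h6
  rw [h5] at key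
  linarith

end Average

/-! ### Large distances: tug-of-war with noise on balls -/

section FarNoisy

variable {n : ℕ} {p σ ε d t : ℝ} {v a b : Rn n}

/-- Together with the passage from `u` to `-u`, this exchanges the roles of the two points, so that
tug-of-war against noise is treated only once. -/
theorem quadIncrement_swap (h g : Rn n) :
    quadIncrement p σ ε d (-v) b a g h = quadIncrement p σ ε d v a b h g := by
  unfold quadIncrement
  rw [inner_neg_right, ← inner_neg_left, neg_sub, norm_sub_rev]
  ring

/-- The answer `h'` to the increment `h`: an almost maximal step away from the other point is
reversed, otherwise `h'` is an almost maximal step towards the other point. -/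
def IsAnswer (ε t : ℝ) (v h h' : Rn n) : Prop :=
  (h' = -h ∧ (1 - t) * ε ≤ inner ℝ h v) ∨ inner ℝ h v + inner ℝ h' v ≤ -(3 / 4 * t * ε)

/-- The pull has length `(1 - t / 4) * ε`, which keeps it in the open ball; against a radial step
below `(1 - t) * ε` a surplus of `3 / 4 * t * ε` remains. -/
theorem exists_isAnswer (hε : 0 < ε) (ht : 0 < t) (ht1 : t ≤ 1) (hv : ‖v‖ = 1) (h : Rn n)
    (hh : ‖h‖ < ε) : ∃ h', ‖h'‖ < ε ∧ IsAnswer ε t v h h' := by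
  by_cases hn : (1 - t) * ε ≤ inner ℝ h v
  · exact ⟨-h, by rwa [norm_neg], Or.inl ⟨rfl, hn⟩⟩
  · refine ⟨(-(1 - t / 4) * ε) • v, ?_, Or.inr ?_⟩
    · rw [norm_smul, hv, Real.norm_eq_abs, mul_one, abs_mul, abs_neg, abs_of_pos hε,
        abs_of_pos (by linarith)]
      nlinarith
    · rw [real_inner_smul_left, real_inner_self_eq_norm_sq, hv]
      nlinarith

theorem inner_le_of_norm_le {a h : Rn n} (ha : ‖a‖ ≤ σ) (hh : ‖h‖ ≤ ε) (hσ : 0 ≤ σ) :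
    inner ℝ a h ≤ σ * ε :=
  (real_inner_le_norm a h).trans (mul_le_mul ha hh (norm_nonneg _) hσ)

theorem quadIncrement_expand (h g : Rn n) : quadIncrement p σ ε d v a b h g =
    2 * d * (inner ℝ h v - inner ℝ g v) + d * (inner ℝ a h + inner ℝ b g)
      + (‖h‖ ^ 2 - 2 * inner ℝ h g + ‖g‖ ^ 2)
      - 2 * (1 - p) * (inner ℝ h v - inner ℝ g v) ^ 2 + σ * ε ^ 2 := by
  rw [quadIncrement, norm_sub_sq_real, inner_sub_left]

theorem sq_norm_le {h : Rn n} (hh : ‖h‖ ≤ ε) : ‖h‖ ^ 2 ≤ ε ^ 2 := by gcongr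

theorem neg_inner_le (hε : 0 ≤ ε) {h g : Rn n} (hh : ‖h‖ ≤ ε) (hg : ‖g‖ ≤ ε) :
    -inner ℝ h g ≤ ε ^ 2 := by
  rw [← inner_neg_left, sq]
  exact inner_le_of_norm_le (by rwa [norm_neg]) hg hε

/-- Both steps are almost maximal and point away from each other. -/
theorem quadIncrement_add_neg_le (hε : 0 < ε) (hp : 0 < p) (hp1 : p ≤ 1 / 16) (hσ1 : σ ≤ 1 / 2)
    (ht1 : t ≤ 1 / 8) {h g : Rn n} (hh : ‖h‖ ≤ ε) (hg : ‖g‖ ≤ ε)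
    (hhv : (1 - t) * ε ≤ inner ℝ h v) (hgv : inner ℝ g v ≤ -((1 - t) * ε)) :
    quadIncrement p σ ε d v a b h g + quadIncrement p σ ε d v a b (-h) (-g) ≤ -2 * ε ^ 2 := by
  simp only [quadIncrement_expand, inner_neg_left, inner_neg_right, norm_neg]
  have h1 := sq_norm_le hh
  have h2 := sq_norm_le hg
  have h3 := neg_inner_le hε.le hh hg
  have h4 : 7 / 4 * ε ≤ inner ℝ h v - inner ℝ g v := by nlinarith
  have h5 : (7 / 4 * ε) ^ 2 ≤ (inner ℝ h v - inner ℝ g v) ^ 2 := by gcongr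
  have h6 : 15 / 8 * (7 / 4 * ε) ^ 2 ≤ 2 * (1 - p) * (inner ℝ h v - inner ℝ g v) ^ 2 := by
    apply mul_le_mul _ h5 (by positivity) (by linarith)
    linarith
  have h7 : σ * ε ^ 2 ≤ 1 / 2 * ε ^ 2 := by gcongr
  nlinarith

/-- The steps and their answers bring the points closer to each other in the mean. -/
theorem quadIncrement_add_le_of_pull (hε : 0 < ε) (hp1 : p ≤ 1) (hσ : 0 ≤ σ)
    (hσ1 : σ ≤ 1 / 2) (hd : 0 < d) (ha : ‖a‖ ≤ σ) (hb : ‖b‖ ≤ σ)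
    {h g h' g' : Rn n} (hh : ‖h‖ ≤ ε) (hg : ‖g‖ ≤ ε) (hh' : ‖h'‖ ≤ ε) (hg' : ‖g'‖ ≤ ε) {l : ℝ}
    (hl : (inner ℝ h v + inner ℝ h' v) - (inner ℝ g v + inner ℝ g' v) ≤ -(l * ε)) :
    quadIncrement p σ ε d v a b h g + quadIncrement p σ ε d v a b h' g' ≤
      d * ε * (4 * σ - 2 * l) + 9 * ε ^ 2 := by
  simp only [quadIncrement_expand]
  have h1 := sq_norm_le hh
  have h2 := sq_norm_le hg
  have h3 := sq_norm_le hh'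
  have h4 := sq_norm_le hg'
  have h5 := neg_inner_le hε.le hh hg
  have h6 := neg_inner_le hε.le hh' hg'
  have h7 := inner_le_of_norm_le ha hh hσ
  have h8 := inner_le_of_norm_le ha hh' hσ
  have h9 := inner_le_of_norm_le hb hg hσ
  have h10 := inner_le_of_norm_le hb hg' hσ
  have h11 : d * ((inner ℝ a h + inner ℝ b g) + (inner ℝ a h' + inner ℝ b g')) ≤
      d * (4 * (σ * ε)) := by gcongr; linarith
  have h12 := mul_le_mul_of_nonneg_left hl (by positivity : 0 ≤ 2 * d)
  have h13 : 0 ≤ 2 * (1 - p) * (inner ℝ h v - inner ℝ g v) ^ 2 := by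
    have : 0 ≤ 1 - p := by linarith
    positivity
  have h14 : 0 ≤ 2 * (1 - p) * (inner ℝ h' v - inner ℝ g' v) ^ 2 := by
    have : 0 ≤ 1 - p := by linarith
    positivity
  have h15 : σ * ε ^ 2 ≤ 1 / 2 * ε ^ 2 := by gcongr
  linarith

/-- If both steps are reversed, the first-order terms cancel and the radial concavity acts on a
displacement of at least `7 / 4 * ε`. Otherwise at least one answer pulls: the first-order gain `d *
t * ε` survives the drifts because `σ ≤ t / 8`, and it beats all second-order terms because `100 / t
* ε ≤ d`. -/
theorem quadIncrement_add_le_of_isAnswer (hε : 0 < ε) (hp : 0 < p) (hp1 : p ≤ 1 / 16)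
    (hσ : 0 ≤ σ) (ht : 0 < t) (ht1 : t ≤ 1 / 8) (hσt : σ ≤ t / 8) (hd : 100 / t * ε ≤ d)
    (ha : ‖a‖ ≤ σ) (hb : ‖b‖ ≤ σ) {h g h' g' : Rn n}
    (hh : ‖h‖ ≤ ε) (hg : ‖g‖ ≤ ε) (hh' : ‖h'‖ ≤ ε) (hg' : ‖g'‖ ≤ ε)
    (hah : IsAnswer ε t v h h') (hag : IsAnswer ε t (-v) g g') :
    quadIncrement p σ ε d v a b h g + quadIncrement p σ ε d v a b h' g' ≤ -2 * ε ^ 2 := by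
  have hd0 : 0 < d := lt_of_lt_of_le (by positivity) hd
  have hdt : 100 * ε ≤ d * t := by
    rw [div_mul_eq_mul_div, div_le_iff₀ ht] at hd; exact hd
  have hte : 0 < t * ε := by positivity
  have hpull : (inner ℝ h v + inner ℝ h' v) - (inner ℝ g v + inner ℝ g' v) ≤ -(3 / 4 * t * ε) →
      quadIncrement p σ ε d v a b h g + quadIncrement p σ ε d v a b h' g' ≤ -2 * ε ^ 2 := by
    intro hl
    have h1 := quadIncrement_add_le_of_pull (p := p) hε (by linarith) hσ (by linarith) hd0 ha hb
      hh hg hh' hg' hl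
    have h2 : d * ε * (4 * σ - 2 * (3 / 4 * t)) ≤ d * ε * (-t) := by
      gcongr; linarith
    nlinarith
  rcases hag with ⟨rfl, hgv⟩ | hgv
  · rw [inner_neg_right] at hgv
    rcases hah with ⟨rfl, hhv⟩ | hhv
    · exact quadIncrement_add_neg_le hε hp hp1 (by linarith) ht1 hh hg hhv (by linarith)
    · apply hpull
      rw [inner_neg_left]
      linarith
  · rw [inner_neg_right, inner_neg_right] at hgv
    apply hpull
    rcases hah with ⟨rfl, hhv⟩ | hhv
    · rw [inner_neg_left]
      linarith
    · linarith

/-- This ball, of probability `(1 / 4) ^ n`, is where the noise is known to have a sizeable radial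
component. -/
theorem inner_ge_of_norm_sub_lt (hv : ‖v‖ = 1) {w : Rn n}
    (hw : ‖w - (ε / 2) • v‖ < 1 / 4 * ε) : ε / 4 ≤ inner ℝ w v := by
  have h1 : inner ℝ w v = inner ℝ (w - (ε / 2) • v) v + ε / 2 := by
    rw [inner_sub_left, real_inner_smul_left, real_inner_self_eq_norm_sq, hv]; ring
  have h2 := (abs_le.1 (abs_real_inner_le_norm (w - (ε / 2) • v) v)).1
  rw [hv, mul_one] at h2
  linarith

theorem norm_lt_of_norm_sub_lt (hε : 0 < ε) (hv : ‖v‖ = 1) {w : Rn n}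
    (hw : ‖w - (ε / 2) • v‖ < 1 / 4 * ε) : ‖w‖ < ε := by
  have h1 : w = (w - (ε / 2) • v) + (ε / 2) • v := by abel
  have h2 : ‖(ε / 2) • v‖ = ε / 2 := by rw [norm_smul, hv, Real.norm_of_nonneg (by positivity), mul_one]
  rw [h1]
  linarith [norm_add_le (w - (ε / 2) • v) ((ε / 2) • v)]

variable {u : Rn n → ℝ} {x z : Rn n} {T Λ : ℝ}

/-- Noise at both points, under the mirror coupling. -/
theorem uniformBall_sub_le_far (hε : 0 < ε) {K : ℝ} (hm : Measurable u) (hK : ∀ y, |u y| ≤ K)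
    (hp1 : p ≤ 1 / 4) (hΛ : 0 < Λ) (hv : ‖v‖ = 1)
    (hσ : σ ≤ (1 / 4) ^ n / 16)
    (hu : ∀ h g : Rn n, ‖h‖ ≤ ε → ‖g‖ ≤ ε →
      u (x + h) - u (z + g) ≤ T + Λ * quadIncrement p σ ε d v a b h g) :
    ∫ y, u y ∂(uniformBall x ε) - ∫ y, u y ∂(uniformBall z ε) ≤
      T - Λ * ((1 / 4) ^ n / 16) * ε ^ 2 := by
  -- The reflection in the hyperplane orthogonal to `v`: the relative displacement `w - e w` is
  -- purely radial.
  set e : Rn n ≃ₗᵢ[ℝ] Rn n := (Submodule.reflection (ℝ ∙ v)).trans (LinearIsometryEquiv.neg ℝ)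
  have he : ∀ w, e w = w - (2 * inner ℝ w v) • v := by
    intro w
    simp only [e, LinearIsometryEquiv.trans_apply, LinearIsometryEquiv.coe_neg,
      Submodule.reflection_singleton_apply, hv, real_inner_comm w v]
    simp only [RCLike.ofReal_real_eq_id, id_eq, one_pow, div_one, two_smul]
    module
  have hkey : ∀ w : Rn n, ‖w‖ < ε → (u (x + w) - u (z + e w)) + (u (x + -w) - u (z + e (-w))) ≤
      2 * (T + Λ * (-4 * (1 - 2 * p) * inner ℝ w v ^ 2 + σ * ε ^ 2)) := by
    intro w hw
    have hew : ‖e w‖ ≤ ε := by rw [e.norm_map]; exact hw.le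
    have h1 := hu w (e w) hw.le hew
    have h2 := hu (-w) (e (-w)) (by rw [norm_neg]; exact hw.le) (by rw [map_neg, norm_neg]; exact hew)
    have h3 : quadIncrement p σ ε d v a b w (e w) + quadIncrement p σ ε d v a b (-w) (e (-w)) =
        2 * (-4 * (1 - 2 * p) * inner ℝ w v ^ 2 + σ * ε ^ 2) := by
      have hw1 : w - e w = (2 * inner ℝ w v) • v := by rw [he]; abel
      have hw2 : -w - e (-w) = -((2 * inner ℝ w v) • v) := by rw [map_neg, ← hw1]; abel
      unfold quadIncrement
      rw [hw1, hw2, map_neg]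
      simp only [inner_neg_left, inner_neg_right, norm_neg, norm_smul, hv, mul_one,
        Real.norm_eq_abs, sq_abs, real_inner_smul_left, real_inner_self_eq_norm_sq]
      ring
    have h4 : Λ * quadIncrement p σ ε d v a b w (e w) +
        Λ * quadIncrement p σ ε d v a b (-w) (e (-w)) =
        Λ * (2 * (-4 * (1 - 2 * p) * inner ℝ w v ^ 2 + σ * ε ^ 2)) := by rw [← mul_add, h3]
    linarith
  have hqn : ‖(ε / 2) • v‖ + 1 / 4 * ε ≤ ε := by
    rw [norm_smul, hv, Real.norm_of_nonneg (by positivity)]; linarith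
  have h5 := uniformBall_sub_le_symm (x := x) (z := z) (T := T + Λ * (σ * ε ^ 2)) (s := Λ * (ε ^ 2 / 8)) hε hm hK e
    (by positivity) (by norm_num : (0 : ℝ) < 1 / 4) hqn ?_ ?_
  · have h6 : Λ * (σ * ε ^ 2) ≤ Λ * ((1 / 4) ^ n / 16 * ε ^ 2) := by gcongr
    linarith
  · intro w hw
    refine (hkey w hw).trans ?_
    have h7 : 0 ≤ (1 - 2 * p) * inner ℝ w v ^ 2 := mul_nonneg (by linarith) (sq_nonneg _)
    gcongr
    linarith
  · intro w hw
    refine (hkey w (norm_lt_of_norm_sub_lt hε hv hw)).trans ?_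
    have h8 : (ε / 4) ^ 2 ≤ inner ℝ w v ^ 2 := by
      have := inner_ge_of_norm_sub_lt hv hw
      gcongr
    have h7 : 1 / 2 * (ε / 4) ^ 2 ≤ (1 - 2 * p) * inner ℝ w v ^ 2 := by
      apply mul_le_mul _ h8 (by positivity) (by linarith)
      linarith
    have h9 : Λ * (-4 * (1 - 2 * p) * inner ℝ w v ^ 2 + σ * ε ^ 2) ≤
      Λ * (σ * ε ^ 2 - ε ^ 2 / 8) := by
      gcongr
      linarith
    linarith

/-- Tug-of-war at one point, noise at the other one. -/
theorem add_sub_two_mul_uniformBall_le_far (hε : 0 < ε) {K : ℝ} (hm : Measurable u)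
    (hK : ∀ y, |u y| ≤ K) (hp : 0 < p) (hp1 : p ≤ (1 / 4) ^ n / 256) (hΛ : 0 < Λ) (hv : ‖v‖ = 1)
    (hσ : 0 ≤ σ) (ht : 0 < t) (ht1 : t ≤ (1 / 4) ^ n / 256) (hσt : σ ≤ t / 8)
    (hd : 100 / t * ε ≤ d) (ha : ‖a‖ ≤ σ)
    (hu : ∀ h g : Rn n, ‖h‖ ≤ ε → ‖g‖ ≤ ε →
      u (x + h) - u (z + g) ≤ T + Λ * quadIncrement p σ ε d v a b h g)
    {h h' : Rn n} (hh : ‖h‖ ≤ ε) (hh' : ‖h'‖ ≤ ε) (hah : IsAnswer ε t v h h') :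
    u (x + h) + u (x + h') - 2 * ∫ y, u y ∂(uniformBall z ε) ≤
      2 * (T - Λ * ((1 / 4) ^ n / 64) * ε ^ 2) := by
  set Q : ℝ := (1 / 4) ^ n with hQ
  have hQ0 : 0 < Q := by positivity
  have hQ1 : Q ≤ 1 := pow_le_one₀ (by norm_num) (by norm_num)
  have hd0 : 0 < d := lt_of_lt_of_le (by positivity) hd
  have hdt : 100 * ε ≤ d * t := by
    rw [div_mul_eq_mul_div, div_le_iff₀ ht] at hd; exact hd
  have hqn : ‖(ε / 2) • v‖ + 1 / 4 * ε ≤ ε := by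
    rw [norm_smul, hv, Real.norm_of_nonneg (by positivity)]; linarith
  have hh2 := sq_norm_le hh
  have hh2' := sq_norm_le hh'
  -- Averaging the four pairings of `h`, `h'` with `w`, `-w` cancels the terms linear in `w`. For a
  -- reversed step the concavity offsets `‖h‖ ^ 2 + ‖w‖ ^ 2` up to an error of order `p + t`, and
  -- the radial part of the noise is left as a gain.
  have hkey : ∀ w : Rn n, ‖w‖ < ε → u (x + h) + u (x + h') - u (z + w) - u (z + -w) ≤
      2 * (T + Λ * (3 * (p + 2 * t) * ε ^ 2 - inner ℝ w v ^ 2)) := by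
    intro w hw
    have hw' : ‖-w‖ ≤ ε := by rw [norm_neg]; exact hw.le
    have hw2 := sq_norm_le hw.le
    have k1 := hu h w hh hw.le
    have k2 := hu h' (-w) hh' hw'
    have k3 := hu h (-w) hh hw'
    have k4 := hu h' w hh' hw.le
    have k5 : quadIncrement p σ ε d v a b h w + quadIncrement p σ ε d v a b h' (-w) +
        quadIncrement p σ ε d v a b h (-w) + quadIncrement p σ ε d v a b h' w ≤
        4 * (3 * (p + 2 * t) * ε ^ 2 - inner ℝ w v ^ 2) := by
      simp only [quadIncrement_expand, inner_neg_left, inner_neg_right, norm_neg]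
      have hpt : 0 ≤ (1 - 2 * p) * inner ℝ w v ^ 2 := mul_nonneg (by linarith) (sq_nonneg _)
      have hpe : 0 < p * ε ^ 2 := by positivity
      have hse : σ * ε ^ 2 ≤ t / 8 * ε ^ 2 := by gcongr
      have hte : 0 < t * ε ^ 2 := by positivity
      rcases hah with ⟨rfl, hhv⟩ | hhv
      · have h1 : ((1 - t) * ε) ^ 2 ≤ inner ℝ h v ^ 2 := by
          have : 0 ≤ 1 - t := by linarith
          gcongr
        have h2 : (1 - p) * ((1 - t) * ε) ^ 2 ≤ (1 - p) * inner ℝ h v ^ 2 :=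
          mul_le_mul_of_nonneg_left h1 (by linarith)
        have h3 : (1 - (p + 2 * t)) * ε ^ 2 ≤ (1 - p) * ((1 - t) * ε) ^ 2 := by
          have : (1 - (p + 2 * t)) ≤ (1 - p) * (1 - t) ^ 2 := by nlinarith [mul_pos ht ht, mul_pos hp ht]
          calc _ ≤ (1 - p) * (1 - t) ^ 2 * ε ^ 2 := by gcongr
            _ = _ := by ring
        simp only [inner_neg_left, inner_neg_right, norm_neg]
        linarith
      · have h1 := inner_le_of_norm_le ha hh hσ
        have h2 := inner_le_of_norm_le ha hh' hσ
        have h3 : d * (inner ℝ a h + inner ℝ a h') ≤ d * (2 * (t / 8 * ε)) := by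
          have : σ * ε ≤ t / 8 * ε := by gcongr
          gcongr
          linarith
        have h4 : d * (inner ℝ h v + inner ℝ h' v) ≤ d * (-(3 / 4 * t * ε)) := by gcongr
        have h5 : 100 * ε * ε ≤ d * t * ε := by gcongr
        have h6 : 0 ≤ (1 - p) * inner ℝ h v ^ 2 := mul_nonneg (by linarith) (sq_nonneg _)
        have h7 : 0 ≤ (1 - p) * inner ℝ h' v ^ 2 := mul_nonneg (by linarith) (sq_nonneg _)
        have h8 : t * ε ^ 2 ≤ 1 * ε ^ 2 := by gcongr; linarith
        linarith
    have k6 := mul_le_mul_of_nonneg_left k5 hΛ.le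
    linarith
  have h5 := two_mul_sub_uniformBall_le_symm (T := T + Λ * (3 * (p + 2 * t) * ε ^ 2))
    (s := Λ * (ε ^ 2 / 16)) (z := z) (A := u (x + h) + u (x + h')) hε hm hK
    (by positivity) (by norm_num : (0 : ℝ) < 1 / 4) hqn ?_ ?_
  · rw [← hQ] at h5
    -- The noise gains `Q * ε ^ 2 / 16` in the mean. This forces `p` and `t` to be small multiples
    -- of `Q`, hence an exponent depending on `n`.
    have h6 : Λ * (3 * (p + 2 * t) * ε ^ 2) ≤ Λ * (9 * Q / 256 * ε ^ 2) := by
      gcongr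
      linarith
    have h7 : 0 < Λ * (Q * ε ^ 2) := by positivity
    linarith
  · intro w hw
    refine (hkey w hw).trans ?_
    gcongr
    linarith [sq_nonneg (inner ℝ w v)]
  · intro w hw
    refine (hkey w (norm_lt_of_norm_sub_lt hε hv hw)).trans ?_
    have h8 : (ε / 4) ^ 2 ≤ inner ℝ w v ^ 2 := by
      have := inner_ge_of_norm_sub_lt hv hw
      gcongr
    have h9 : Λ * (3 * (p + 2 * t) * ε ^ 2 - inner ℝ w v ^ 2) ≤
        Λ * (3 * (p + 2 * t) * ε ^ 2 - ε ^ 2 / 16) := by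
      gcongr
      linarith
    linarith

end FarNoisy

/-! ### The gain conditions for the games (a)–(c) -/

section Noisy

variable {n : ℕ} {ε : ℝ} {α : Rn n → ℝ} {Ω : Set (Rn n)} {u : Rn n → ℝ} {x z : Rn n}

theorem tugOfWar_eq_noisyTugOfWar (ε : ℝ) :
    (tugOfWar ε : Rn n → Set (Measure (Rn n))) = noisyTugOfWar (fun _ => 1) ε := by
  funext x
  simp [tugOfWar, noisyTugOfWar]

theorem randomWalk_eq_noisyTugOfWar (hε : 0 < ε) :
    (randomWalk ε : Rn n → Set (Measure (Rn n))) = noisyTugOfWar (fun _ => 0) ε := by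
  funext x
  ext μ
  simp only [randomWalk, noisyTugOfWar, ENNReal.ofReal_zero, zero_smul, sub_zero,
    ENNReal.ofReal_one, one_smul, zero_add, mem_singleton_iff, mem_ofPred_eq]
  exact ⟨fun h => ⟨x, mem_ball_self hε, h⟩, fun ⟨_, _, h⟩ => h⟩

theorem sub_le_of_noisy (hε : 0 < ε) (hα : ∀ y ∈ Ω, 0 ≤ α y ∧ α y ≤ 1)
    (hu : SatisfiesDPP (noisyTugOfWar α ε) (noisyTugOfWar α ε) Ω u) {K : ℝ} (hm : Measurable u)
    (hK : ∀ y, |u y| ≤ K) (hx : x ∈ Ω) (hz : z ∈ Ω) {T : ℝ}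
    (h : ∀ h g : Rn n, ‖h‖ < ε → ‖g‖ < ε → ∃ h' g' : Rn n, ‖h'‖ < ε ∧ ‖g'‖ < ε ∧
      α x * (u (x + h) + u (x + h')) + (1 - α x) * (2 * ∫ y, u y ∂(uniformBall x ε))
        - (α z * (u (z + g) + u (z + g')) + (1 - α z) * (2 * ∫ y, u y ∂(uniformBall z ε)))
        ≤ 2 * T) :
    u x - u z ≤ T := by
  have hprob := fun y : Rn n => isProbabilityMeasure_uniformBall hε y
  have hmem : ∀ y w : Rn n, w ∈ ball y ε → ‖w - y‖ < ε := fun y w hw => by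
    rwa [mem_ball, dist_eq_norm] at hw
  refine hu.sub_le hK hx hz (fun y => ⟨_, y, mem_ball_self hε, rfl⟩) ?_ ?_
  · rintro y hy _ ⟨w, _, rfl⟩
    have := hprob y
    exact isProbabilityMeasure_mix (hα y hy).1 (hα y hy).2 w _
  · rintro _ ⟨X, hX, rfl⟩ _ ⟨Z, hZ, rfl⟩
    obtain ⟨h', g', hh', hg', hle⟩ := h (X - x) (Z - z) (hmem _ _ hX) (hmem _ _ hZ)
    refine ⟨_, ⟨x + h', by simpa using hh', rfl⟩, _, ⟨z + g', by simpa using hg', rfl⟩, ?_⟩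
    have := hprob x
    have := hprob z
    simp only [integral_mix (hα x hx).1 (hα x hx).2 hm hK,
      integral_mix (hα z hz).1 (hα z hz).2 hm hK]
    rw [add_sub_cancel, add_sub_cancel] at hle
    linarith

/-- The coins are coupled maximally: tug-of-war at both points has weight `b`, tug-of-war against
noise `a - b`, noise at both points `1 - a`. -/
theorem mix_sub_mix_le {a b P Q U V T s₁ s₂ s₃ : ℝ} (hb : 0 ≤ b) (hab : b ≤ a) (ha : a ≤ 1)
    (h₁ : P - Q ≤ 2 * T - s₁) (h₂ : P - 2 * V ≤ 2 * T - s₂) (h₃ : U - V ≤ T - s₃) :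
    a * P + (1 - a) * (2 * U) - (b * Q + (1 - b) * (2 * V)) ≤
      2 * T - (b * s₁ + (a - b) * s₂ + (1 - a) * (2 * s₃)) := by
  have k1 := mul_le_mul_of_nonneg_left h₁ hb
  have k2 := mul_le_mul_of_nonneg_left h₂ (sub_nonneg.2 hab)
  have k3 := mul_le_mul_of_nonneg_left h₃ (sub_nonneg.2 ha)
  linarith

theorem mix_sub_mix_le' {a b P Q U V T s₁ s₂ s₃ : ℝ} (ha : 0 ≤ a) (hab : a ≤ b) (hb : b ≤ 1)
    (h₁ : P - Q ≤ 2 * T - s₁) (h₂ : 2 * U - Q ≤ 2 * T - s₂) (h₃ : U - V ≤ T - s₃) :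
    a * P + (1 - a) * (2 * U) - (b * Q + (1 - b) * (2 * V)) ≤
      2 * T - (a * s₁ + (b - a) * s₂ + (1 - b) * (2 * s₃)) := by
  have k1 := mul_le_mul_of_nonneg_left h₁ ha
  have k2 := mul_le_mul_of_nonneg_left h₂ (sub_nonneg.2 hab)
  have k3 := mul_le_mul_of_nonneg_left h₃ (sub_nonneg.2 hb)
  linarith

/-- A weighted mean of gains is at least the smallest gain. -/
theorem le_weighted_sum {b c q s₁ s₂ s₃ : ℝ} (hb : 0 ≤ b) (hbc : b ≤ c) (hc : c ≤ 1)
    (h₁ : q ≤ s₁) (h₂ : q ≤ s₂) (h₃ : q ≤ s₃) : q ≤ b * s₁ + (c - b) * s₂ + (1 - c) * s₃ := by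
  have k1 := mul_le_mul_of_nonneg_left h₁ hb
  have k2 := mul_le_mul_of_nonneg_left h₂ (sub_nonneg.2 hbc)
  have k3 := mul_le_mul_of_nonneg_left h₃ (sub_nonneg.2 hc)
  linarith

/-- The answer `h'` depends on `h` and `v` alone, so the same answer serves against tug-of-war and
against noise at the other point; likewise for `g'`. All the pairings have the same gain, so the
values of `α` do not matter. -/
theorem farGain_of_noisy (hε : 0 < ε) (hα : ∀ y ∈ Ω, 0 ≤ α y ∧ α y ≤ 1)
    (hu : SatisfiesDPP (noisyTugOfWar α ε) (noisyTugOfWar α ε) Ω u) {K : ℝ} (hm : Measurable u)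
    (hK : ∀ y, |u y| ≤ K) (hx : x ∈ Ω) (hz : z ∈ Ω) {p t σ : ℝ} (hp : 0 < p)
    (hp1 : p ≤ (1 / 4) ^ n / 256) (hσ : 0 ≤ σ) (ht : 0 < t) (ht1 : t ≤ (1 / 4) ^ n / 256)
    (hσt : σ ≤ t / 8) : FarGain p (100 / t) σ ((1 / 4) ^ n / 64) ε u x z := by
  intro T Λ d v a b hΛ hd hv ha hb hinc
  have hQ0 : (0 : ℝ) < (1 / 4) ^ n := by positivity
  have hQ1 : (1 / 4 : ℝ) ^ n ≤ 1 := pow_le_one₀ (by norm_num) (by norm_num)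
  set G := Λ * ((1 / 4) ^ n / 64) * ε ^ 2 with hG
  have hG1 : G ≤ Λ * ε ^ 2 := by
    have : Λ * ((1 / 4) ^ n / 64) ≤ Λ * 1 := by gcongr; linarith
    calc G ≤ Λ * 1 * ε ^ 2 := by rw [hG]; gcongr
      _ = _ := by ring
  have hnv : ‖-v‖ = 1 := by rwa [norm_neg]
  have hinc' : ∀ g h : Rn n, ‖g‖ ≤ ε → ‖h‖ ≤ ε →
      (-u) (z + g) - (-u) (x + h) ≤ T + Λ * quadIncrement p σ ε d (-v) b a g h := by
    intro g h hg hh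
    have := hinc h g hh hg
    rw [quadIncrement_swap]
    simp only [Pi.neg_apply]
    linarith
  apply sub_le_of_noisy hε hα hu hm hK hx hz
  intro h g hh hg
  obtain ⟨h', hh', hah⟩ := exists_isAnswer (v := v) hε ht (by linarith) hv h hh
  obtain ⟨g', hg', hag⟩ := exists_isAnswer (v := -v) hε ht (by linarith) hnv g hg
  refine ⟨h', g', hh', hg', ?_⟩
  have h1 : (u (x + h) + u (x + h')) - (u (z + g) + u (z + g')) ≤ 2 * T - 2 * G := by
    have k := quadIncrement_add_le_of_isAnswer (p := p) hε hp (by linarith) hσ ht (by linarith)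
      hσt hd ha hb hh.le hg.le hh'.le hg'.le hah hag
    have k1 := hinc h g hh.le hg.le
    have k2 := hinc h' g' hh'.le hg'.le
    have k3 := mul_le_mul_of_nonneg_left k hΛ.le
    linarith
  have h2 := add_sub_two_mul_uniformBall_le_far hε hm hK hp hp1 hΛ hv hσ ht ht1 hσt hd ha hinc
    hh.le hh'.le hah
  have h3 := add_sub_two_mul_uniformBall_le_far (u := -u) (K := K) hε hm.neg
    (fun y => by simpa using hK y) hp hp1 hΛ hnv hσ ht ht1 hσt hd hb hinc' hg.le hg'.le hag
  have h4 := uniformBall_sub_le_far hε hm hK (by linarith) hΛ hv (by linarith) hinc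
  simp only [Pi.neg_apply, integral_neg] at h3
  have h5 : Λ * ((1 / 4) ^ n / 64) * ε ^ 2 ≤ Λ * ((1 / 4) ^ n / 16) * ε ^ 2 := by
    gcongr
    norm_num
  rw [← hG] at h2 h3 h5
  rcases le_total (α z) (α x) with hzx | hxz
  · have := mix_sub_mix_le (s₁ := 2 * G) (s₂ := 2 * G) (s₃ := G) (hα z hz).1 hzx (hα x hx).2 h1
      (by linarith) (h4.trans (by linarith))
    linarith
  · have := mix_sub_mix_le' (s₁ := 2 * G) (s₂ := 2 * G) (s₃ := G) (hα x hx).1 hxz (hα z hz).2 h1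
      (by linarith) (h4.trans (by linarith))
    linarith

/-- Comparison of a value `A` with an average over a ball. -/
theorem sub_uniformBall_le (hε : 0 < ε) {K : ℝ} (hm : Measurable u) (hK : ∀ y, |u y| ≤ K)
    {A T s r : ℝ} {S : Set (Rn n)} (hS : MeasurableSet S) (hs : 0 ≤ s)
    (hr : r ≤ (uniformBall 0 ε).real S)
    (hT : ∀ w : Rn n, ‖w‖ < ε → A - u (z + w) ≤ T)
    (hTs : ∀ w ∈ S, ‖w‖ < ε → A - u (z + w) ≤ T - s) :
    A - ∫ y, u y ∂(uniformBall z ε) ≤ T - r * s := by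
  have := isProbabilityMeasure_uniformBall hε (0 : Rn n)
  have e1 := integral_uniformBall (u := u) (ε := ε) z (LinearIsometryEquiv.refl ℝ _)
  have i1 : Integrable (fun w => u (z + w)) (uniformBall 0 ε) :=
    integrable_of_abs_le (hm.comp (measurable_const.add measurable_id)) (fun w => hK _)
  have i0 : Integrable (fun _ : Rn n => A) (uniformBall 0 ε) := integrable_const A
  have h1 : ∫ w, (A - u (z + w)) ∂(uniformBall 0 ε) ≤ T - r * s := by
    refine integral_le_sub_mul (S := S) (i0.sub i1) hS hs hr ?_ ?_
    · filter_upwards [ae_uniformBall_mem 0] with w hw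
      exact hT w (by simpa using hw)
    · filter_upwards [ae_uniformBall_mem 0] with w hw hwS
      exact hTs w hwS (by simpa using hw)
  have h2 := integral_sub i0 i1
  have h3 : ∫ _, A ∂(uniformBall (0 : Rn n) ε) = A := by simp
  rw [h3] at h2
  rw [e1]
  exact h2.symm.le.trans h1

/-- At a small distance, one of two points lies on the same side of the dichotomy `τ` as at least
half of a ball. -/
theorem exists_sub_uniformBall_le (hε : 0 < ε) {K : ℝ} (hm : Measurable u) (hK : ∀ y, |u y| ≤ K)
    {τ : Rn n → Prop} (hτ : MeasurableSet {y | τ y}) (hne : ¬(τ x ↔ τ z))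
    {T s : ℝ} (hs : 0 ≤ s)
    (hT : ∀ y, y = x ∨ y = z → ∀ w : Rn n, ‖w‖ < ε → u y - u (z + w) ≤ T)
    (hTs : ∀ y, y = x ∨ y = z → ∀ w : Rn n, ‖w‖ < ε → (τ y ↔ τ (z + w)) →
      u y - u (z + w) ≤ T - s) :
    ∃ y, (y = x ∨ y = z) ∧ u y - ∫ y, u y ∂(uniformBall z ε) ≤ T - 1 / 2 * s := by
  have := isProbabilityMeasure_uniformBall hε (0 : Rn n)
  set S : Set (Rn n) := {w | τ (z + w)} with hSdef
  have hS : MeasurableSet S := (measurable_const.add measurable_id : Measurable fun w : Rn n => z + w) hτ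
  have hsum := probReal_add_probReal_compl (μ := uniformBall (0 : Rn n) ε) hS
  have hyes : ∃ y, (y = x ∨ y = z) ∧ τ y := by
    by_cases hx : τ x
    · exact ⟨x, Or.inl rfl, hx⟩
    · exact ⟨z, Or.inr rfl, by tauto⟩
  have hno : ∃ y, (y = x ∨ y = z) ∧ ¬τ y := by
    by_cases hx : τ x
    · exact ⟨z, Or.inr rfl, by tauto⟩
    · exact ⟨x, Or.inl rfl, hx⟩
  rcases le_total (1 / 2) ((uniformBall (0 : Rn n) ε).real S) with h | h
  · obtain ⟨y, hy, hty⟩ := hyes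
    exact ⟨y, hy, sub_uniformBall_le hε hm hK hS hs h (hT y hy) fun w hw hwε =>
      hTs y hy w hwε (iff_of_true hty hw)⟩
  · obtain ⟨y, hy, hty⟩ := hno
    exact ⟨y, hy, sub_uniformBall_le hε hm hK hS.compl hs (by linarith) (hT y hy) fun w hw hwε =>
      hTs y hy w hwε (iff_of_false hty hw)⟩

/-- At level one the points can meet whenever the same kind of step is made at both, and the values
of `α` differ by at most `1 / 2`. At level two they differ in `τ` but are so close that each can
step onto the other, and a step to the right one of them puts it on the same side as half of the
noise. Above that, every pairing can shrink the distance by `ε / 10`. -/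
theorem nearGain_of_noisy (hε : 0 < ε) (hαm : Measurable α) (hα : ∀ y ∈ Ω, 0 ≤ α y ∧ α y ≤ 1)
    (hu : SatisfiesDPP (noisyTugOfWar α ε) (noisyTugOfWar α ε) Ω u) {K : ℝ} (hm : Measurable u)
    (hK : ∀ y, |u y| ≤ K) (hx : x ∈ Ω) (hz : z ∈ Ω) :
    NearGain ((1 / 20) ^ n / 4) ε (fun y => 1 / 2 ≤ α y) u x z := by
  intro hxz T s hs hT hTs
  set τ : Rn n → Prop := fun y => 1 / 2 ≤ α y with hτ
  have hτm : MeasurableSet {y | τ y} := measurableSet_le measurable_const hαm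
  set q : ℝ := (1 / 20) ^ n with hq
  have hq0 : 0 < q := by positivity
  have hq1 : q ≤ 1 := pow_le_one₀ (by norm_num) (by norm_num)
  have hq4 : q ≤ (1 / 4) ^ n := pow_le_pow_left₀ (by norm_num) (by norm_num) n
  have hqs : q * s ≤ s := by nlinarith
  have hqs0 : 0 ≤ q * s := by positivity
  have hqs4 : q * s ≤ (1 / 4) ^ n * s := by gcongr
  obtain ⟨ha0, ha1⟩ := hα x hx
  obtain ⟨hb0, hb1⟩ := hα z hz
  have hT' : ∀ h g : Rn n, ‖h‖ < ε → ‖g‖ < ε → u (x + h) - u (z + g) ≤ T := fun h g hh hg =>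
    hT _ (by simpa using hh.le) _ (by simpa using hg.le)
  have hTs' : ∀ h g : Rn n, ‖h‖ < ε → ‖g‖ < ε → level τ ε (x + h) (z + g) < level τ ε x z →
      u (x + h) - u (z + g) ≤ T - s := fun h g hh hg =>
    hTs _ (by simpa using hh.le) _ (by simpa using hg.le)
  have h0 : ‖(0 : Rn n)‖ < ε := by simpa using hε
  have hmeet : ∀ h g : Rn n, ‖h‖ < ε → ‖g‖ < ε → x + h = z + g → s ≤ T := by
    intro h g hh hg hhg
    have := hTs' h g hh hg (by rw [hhg, level_self]; exact level_pos hxz)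
    rw [hhg] at this
    linarith
  have hmixT : ∀ h : Rn n, ‖h‖ < ε → u (x + h) - ∫ y, u y ∂(uniformBall z ε) ≤ T := by
    intro h hh
    have := sub_uniformBall_le (z := z) (A := u (x + h)) (r := 0) hε hm hK MeasurableSet.empty hs
      (by simp) (fun w hw => hT' h w hh hw) (by simp)
    linarith
  have hmixT' : ∀ g : Rn n, ‖g‖ < ε → ∫ y, u y ∂(uniformBall x ε) - u (z + g) ≤ T := by
    intro g hg
    have := sub_uniformBall_le (u := -u) (K := K) (z := x) (A := -u (z + g)) (T := T) (r := 0)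
      hε hm.neg (fun y => by simpa using hK y) MeasurableSet.empty hs
      (by simp) (fun w hw => by have := hT' w g hw hg; simp only [Pi.neg_apply]; linarith) (by simp)
    simp only [Pi.neg_apply, integral_neg] at this
    linarith
  apply sub_le_of_noisy hε hα hu hm hK hx hz
  intro h g hh hg
  have hopp := hT' h g hh hg
  rcases level_cases τ (ε := ε) hxz with ⟨hl, hty, hd⟩ | ⟨hl, hd⟩ | ⟨hl, hd⟩
  · -- the increments `∓ (x - z) / 2` let the two points meet
    have hhalf : ‖(1 / 2 : ℝ) • (x - z)‖ < ε := by
      rw [norm_smul]; norm_num; linarith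
    have hhalf' : ‖-((1 / 2 : ℝ) • (x - z))‖ < ε := by rwa [norm_neg]
    have heq : x + -((1 / 2 : ℝ) • (x - z)) = z + (1 / 2 : ℝ) • (x - z) := by module
    refine ⟨-((1 / 2 : ℝ) • (x - z)), (1 / 2 : ℝ) • (x - z), hhalf', hhalf, ?_⟩
    have hsT := hmeet _ _ hhalf' hhalf heq
    have k1 : (u (x + h) + u (x + -((1 / 2 : ℝ) • (x - z)))) -
        (u (z + g) + u (z + (1 / 2 : ℝ) • (x - z))) ≤ 2 * T - s := by
      rw [heq]
      linarith
    have k4 := uniformBall_sub_le_of_overlap hε hm hK hd hsT hs fun X hX Z hZ =>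
      hT X (ball_subset_closedBall hX) Z (ball_subset_closedBall hZ)
    rcases le_total (α z) (α x) with hzx | hzx
    · have k2 := mix_sub_mix_le (s₁ := q * s) (s₂ := 0) (s₃ := q * s / 2) hb0 hzx ha1
        (k1.trans (by linarith))
        (by linarith [hmixT h hh, hmixT _ hhalf'] : u (x + h) + u (x + -((1 / 2 : ℝ) • (x - z))) -
          2 * ∫ y, u y ∂(uniformBall z ε) ≤ 2 * T - 0) (k4.trans (by linarith))
      have k3 : α x - α z ≤ 1 / 2 := by
        simp only [hτ] at hty
        by_cases h1 : 1 / 2 ≤ α x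
        · linarith [hty.1 h1]
        · linarith
      nlinarith
    · have k2 := mix_sub_mix_le' (s₁ := q * s) (s₂ := 0) (s₃ := q * s / 2) ha0 hzx hb1
        (k1.trans (by linarith))
        (by linarith [hmixT' g hg, hmixT' _ hhalf] : 2 * (∫ y, u y ∂(uniformBall x ε)) -
          (u (z + g) + u (z + (1 / 2 : ℝ) • (x - z))) ≤ 2 * T - 0) (k4.trans (by linarith))
      have k3 : α z - α x ≤ 1 / 2 := by
        simp only [hτ] at hty
        by_cases h1 : 1 / 2 ≤ α z
        · linarith [hty.2 h1]
        · linarith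
      nlinarith
  · have hd' : ‖x - z‖ < ε := by linarith
    have hd'' : ‖z - x‖ < ε := by rwa [norm_sub_rev]
    have hne : ¬(τ x ↔ τ z) := by
      intro hty
      have := level_le_one (ε := ε) hty (by linarith)
      omega
    have hsT := hmeet 0 (x - z) h0 hd' (by abel)
    have k4 := uniformBall_sub_le_of_overlap hε hm hK (by linarith : ‖x - z‖ ≤ 3 / 2 * ε) hsT hs
      fun X hX Z hZ => hT X (ball_subset_closedBall hX) Z (ball_subset_closedBall hZ)
    have hmem : ∀ y, y = x ∨ y = z → ‖y - x‖ < ε ∧ ‖y - z‖ < ε := by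
      rintro y (rfl | rfl)
      · exact ⟨by simpa using hε, hd'⟩
      · exact ⟨hd'', by simpa using hε⟩
    have hclose : ∀ y, y = x ∨ y = z → ‖y - x‖ ≤ ε / 2 ∧ ‖y - z‖ ≤ ε / 2 := by
      rintro y (rfl | rfl)
      · exact ⟨by rw [sub_self, norm_zero]; positivity, hd⟩
      · exact ⟨by rwa [norm_sub_rev], by rw [sub_self, norm_zero]; positivity⟩
    rcases le_total (α z) (α x) with hzx | hzx
    -- Both answers lead to the same `y`: the points meet if tug-of-war is played at both, and
    -- against noise at `z` level one is reached with probability at least `1 / 2`.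
    · obtain ⟨y, hy, hyle⟩ := exists_sub_uniformBall_le (x := x) (z := z) hε hm hK hτm hne (T := T)
        hs
        (fun y hy w hw => by simpa using hT' (y - x) w (hmem y hy).1 hw)
        (fun y hy w hw htw => by
          have hlev : level τ ε y (z + w) ≤ 1 := by
            refine level_le_one htw ?_
            have : y - (z + w) = (y - z) - w := by abel
            rw [this]
            linarith [norm_sub_le (y - z) w, (hclose y hy).2]
          simpa using hTs' (y - x) w (hmem y hy).1 hw (by rw [add_sub_cancel, hl]; omega))
      refine ⟨y - x, y - z, (hmem y hy).1, (hmem y hy).2, ?_⟩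
      rw [add_sub_cancel, add_sub_cancel]
      have k2 := mix_sub_mix_le (P := u (x + h) + u y) (Q := u (z + g) + u y) (T := T) (s₁ := q * s / 2)
        (s₂ := q * s / 2) (s₃ := q * s / 4) hb0 hzx ha1 (by linarith)
        (by linarith [hmixT h hh]) (k4.trans (by linarith))
      linarith
    · obtain ⟨y, hy, hyle⟩ := exists_sub_uniformBall_le (u := -u) (K := K) (x := z) (z := x) hε
        hm.neg (fun y => by simpa using hK y) hτm (fun h => hne h.symm) (T := T) hs
        (fun y hy w hw => by
          have := hT' w (y - z) hw (hmem y hy.symm).2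
          rw [add_sub_cancel] at this
          simp only [Pi.neg_apply]; linarith)
        (fun y hy w hw htw => by
          have hlev : level τ ε (x + w) y ≤ 1 := by
            refine level_le_one htw.symm ?_
            have : x + w - y = w - (y - x) := by abel
            rw [this]
            linarith [norm_sub_le w (y - x), (hclose y hy.symm).1]
          have := hTs' w (y - z) hw (hmem y hy.symm).2 (by rw [add_sub_cancel, hl]; omega)
          rw [add_sub_cancel] at this
          simp only [Pi.neg_apply]; linarith)
      simp only [Pi.neg_apply, integral_neg] at hyle
      refine ⟨y - x, y - z, (hmem y hy.symm).1, (hmem y hy.symm).2, ?_⟩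
      rw [add_sub_cancel, add_sub_cancel]
      have k2 := mix_sub_mix_le' (P := u (x + h) + u y) (Q := u (z + g) + u y) (T := T) (s₁ := q * s / 2)
        (s₂ := q * s / 2) (s₃ := q * s / 4) ha0 hzx hb1 (by linarith)
        (by linarith [hmixT' g hg]) (k4.trans (by linarith))
      linarith
  · have hd0 : 0 < ‖x - z‖ := by linarith
    obtain ⟨v, hv, hdv⟩ : ∃ v : Rn n, ‖v‖ = 1 ∧ x - z = ‖x - z‖ • v := by
      refine ⟨(1 / ‖x - z‖) • (x - z), ?_, ?_⟩
      · rw [norm_smul, Real.norm_of_nonneg (by positivity)]; field_simp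
      · rw [smul_smul, mul_one_div_cancel hd0.ne', one_smul]
    have hnv : ∀ r : ℝ, 0 ≤ r → ‖r • v‖ = r := fun r hr => by
      rw [norm_smul, hv, mul_one, Real.norm_of_nonneg hr]
    have hdrop : ∀ (h g : Rn n) (r : ℝ), ‖h - g + r • v‖ ≤ r - ε / 10 → r ≤ ‖x - z‖ →
        level τ ε (x + h) (z + g) < level τ ε x z := by
      intro h g r hr hrd
      apply level_lt_of_norm_le hε hl
      have : x + h - (z + g) = (h - g + r • v) + (‖x - z‖ - r) • v := by
        rw [sub_smul, ← hdv]; abel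
      rw [this]
      have := hnv (‖x - z‖ - r) (by linarith)
      linarith [norm_add_le (h - g + r • v) ((‖x - z‖ - r) • v)]
    have hq4v : ‖(ε / 4) • v‖ < ε := by rw [hnv _ (by positivity)]; linarith
    have hq4v' : ‖-((ε / 4) • v)‖ < ε := by rwa [norm_neg]
    -- Together these steps shorten the distance by `ε / 2`, without overshooting since `ε / 2 < ‖x
    -- - z‖`. Against noise within `ε / 20` of the other point, `ε / 4 - ε / 20` remains.
    refine ⟨-((ε / 4) • v), (ε / 4) • v, hq4v', hq4v, ?_⟩
    have k1 := hTs' _ _ hq4v' hq4v (hdrop _ _ (ε / 2) (by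
      have : -((ε / 4) • v) - (ε / 4) • v + (ε / 2) • v = 0 := by module
      rw [this, norm_zero]; linarith) hd.le)
    have hball : q ≤ (uniformBall (0 : Rn n) ε).real (ball 0 (1 / 20 * ε)) :=
      (uniformBall_real_ball hε (by norm_num) (by rw [norm_zero]; linarith)).ge
    have k2 := sub_uniformBall_le (z := z) (A := u (x + -((ε / 4) • v))) hε hm hK measurableSet_ball
      hs hball (fun w hw => hT' _ w hq4v' hw) (fun w hw hwε => hTs' _ w hq4v' hwε
        (hdrop _ _ (ε / 4) (by
          have : -((ε / 4) • v) - w + (ε / 4) • v = -w := by abel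
          rw [this, norm_neg]
          rw [mem_ball_zero_iff] at hw
          linarith) (by linarith)))
    have k3 := sub_uniformBall_le (u := -u) (K := K) (z := x) (A := -u (z + (ε / 4) • v)) (T := T)
      hε hm.neg (fun y => by simpa using hK y) measurableSet_ball hs hball
      (fun w hw => by have := hT' w _ hw hq4v; simp only [Pi.neg_apply]; linarith)
      (fun w hw hwε => by
        have := hTs' w _ hwε hq4v (hdrop _ _ (ε / 4) (by
          have : w - (ε / 4) • v + (ε / 4) • v = w := by abel
          rw [this]
          rw [mem_ball_zero_iff] at hw
          linarith) (by linarith))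
        simp only [Pi.neg_apply]; linarith)
    simp only [Pi.neg_apply, integral_neg] at k3
    -- For opposite noise `w`, `-w` with `w` within `ε / 20` of `-(ε / 5) • v`, the distance shrinks
    -- by at least `2 / 5 * ε - ε / 10`.
    have k4 := uniformBall_sub_le (x := x) (z := z) (T := T) (s := s) (r := 1 / 20)
      (q := -((ε / 5) • v)) hε hm hK (LinearIsometryEquiv.neg ℝ) hs (by norm_num)
      (by rw [norm_neg, hnv _ (by positivity)]; linarith)
      (fun w hw => hT' w (-w) hw (by rwa [norm_neg]))
      (fun w hw => by
        have hwε : ‖w‖ < ε := by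
          have : w = (w - -((ε / 5) • v)) - (ε / 5) • v := by abel
          rw [this]
          linarith [norm_sub_le (w - -((ε / 5) • v)) ((ε / 5) • v), hnv (ε / 5) (by positivity)]
        refine hTs' w (-w) hwε (by rwa [norm_neg]) (hdrop _ _ (2 / 5 * ε) ?_ (by linarith))
        have : w - -w + (2 / 5 * ε) • v = (2 : ℝ) • (w - -((ε / 5) • v)) := by module
        rw [this, norm_smul]
        norm_num at hw ⊢
        linarith)
    rcases le_total (α z) (α x) with hzx | hzx
    · have := mix_sub_mix_le (P := u (x + h) + u (x + -((ε / 4) • v)))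
        (Q := u (z + g) + u (z + (ε / 4) • v)) (s₁ := q * s)
        (s₂ := q * s) (s₃ := q * s) hb0 hzx ha1 (by linarith) (by linarith [hmixT h hh]) k4
      have k5 := le_weighted_sum (q := q * s) (s₃ := 2 * (q * s)) hb0 hzx ha1 le_rfl le_rfl
        (by linarith)
      linarith
    · have := mix_sub_mix_le' (P := u (x + h) + u (x + -((ε / 4) • v)))
        (Q := u (z + g) + u (z + (ε / 4) • v)) (s₁ := q * s)
        (s₂ := q * s) (s₃ := q * s) ha0 hzx hb1 (by linarith) (by linarith [hmixT' g hg]) k4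
      have k5 := le_weighted_sum (q := q * s) (s₃ := 2 * (q * s)) ha0 hzx hb1 le_rfl le_rfl
        (by linarith)
      linarith

end Noisy

/-! ### Uniform distributions on hyperplane discs -/

/-- Linear isometries preserve the Lebesgue measures given by orthonormal bases. -/
theorem map_orthonormalBasis_addHaar {E F ι ι' : Type*} [Fintype ι] [Fintype ι']
    [NormedAddCommGroup E] [InnerProductSpace ℝ E] [FiniteDimensional ℝ E] [MeasurableSpace E]
    [BorelSpace E] [NormedAddCommGroup F] [InnerProductSpace ℝ F] [FiniteDimensional ℝ F]
    [MeasurableSpace F] [BorelSpace F] (b : OrthonormalBasis ι ℝ E) (b' : OrthonormalBasis ι' ℝ F)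
    (e : E ≃ₗᵢ[ℝ] F) : b.toBasis.addHaar.map e = b'.toBasis.addHaar := by
  let _ : MeasureSpace F := measureSpaceOfInnerProductSpace
  let _ : MeasureSpace E := measureSpaceOfInnerProductSpace
  rw [b.addHaar_eq_volume, b'.addHaar_eq_volume]
  exact e.measurePreserving.map_eq

section Disc

variable {n : ℕ} {ε : ℝ} {u : Rn n → ℝ}

/-- The uniform probability distribution on the disc of radius `ε` in the hyperplane `ν^⊥`. -/
noncomputable def hyperplaneDisc (ν : Rn n) (ε : ℝ) : Measure (Submodule.orthogonal (ℝ ∙ ν)) :=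
  (hyperplaneLebesgue ν (ball 0 ε))⁻¹ • (hyperplaneLebesgue ν).restrict (ball 0 ε)

theorem isProbabilityMeasure_hyperplaneDisc (hε : 0 < ε) (ν : Rn n) :
    IsProbabilityMeasure (hyperplaneDisc ν ε) := by
  have : (hyperplaneLebesgue ν).IsAddHaarMeasure := by
    unfold hyperplaneLebesgue; infer_instance
  constructor
  simp only [hyperplaneDisc, Measure.smul_apply, Measure.restrict_apply_univ, smul_eq_mul]
  exact ENNReal.inv_mul_cancel (measure_ball_pos _ _ hε).ne' measure_ball_lt_top.ne

theorem ae_hyperplaneDisc_norm_lt (ν : Rn n) :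
    ∀ᵐ (h : Submodule.orthogonal (ℝ ∙ ν)) ∂(hyperplaneDisc ν ε), ‖(h : Rn n)‖ < ε := by
  refine Measure.ae_smul_measure ?_ _
  filter_upwards [ae_restrict_mem measurableSet_ball] with h hh
  simpa using hh

theorem measurable_add_coe (x ν : Rn n) :
    Measurable fun h : Submodule.orthogonal (ℝ ∙ ν) => x + (h : Rn n) :=
  measurable_const.add measurable_subtype_coe

theorem isProbabilityMeasure_uniformDisc (hε : 0 < ε) (x ν : Rn n) :
    IsProbabilityMeasure (uniformDisc x ν ε) :=
  have := isProbabilityMeasure_hyperplaneDisc hε ν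
  Measure.isProbabilityMeasure_map (μ := hyperplaneDisc ν ε) (measurable_add_coe x ν).aemeasurable

theorem ae_uniformDisc_mem (x ν : Rn n) : ∀ᵐ y ∂(uniformDisc x ν ε), y ∈ closedBall x ε := by
  unfold uniformDisc
  rw [ae_map_iff (p := fun y => y ∈ closedBall x ε) (measurable_add_coe x ν).aemeasurable
    measurableSet_closedBall]
  filter_upwards [ae_hyperplaneDisc_norm_lt ν] with h hh
  simpa using hh.le

/-- Uniform sampling from a disc, parametrized by an isometric disc around the origin. -/
theorem integral_uniformDisc (hm : Measurable u) (z : Rn n) {ν ν' : Rn n} (e : Rn n ≃ₗᵢ[ℝ] Rn n)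
    (he : ∀ h, inner ℝ ν h = 0 ↔ inner ℝ ν' (e h) = 0) :
    ∫ y, u y ∂(uniformDisc z ν' ε) = ∫ h, u (z + e (h : Rn n)) ∂(hyperplaneDisc ν ε) := by
  have hmap : (Submodule.orthogonal (ℝ ∙ ν)).map (e.toLinearEquiv : Rn n →ₗ[ℝ] Rn n) =
      Submodule.orthogonal (ℝ ∙ ν') := by
    ext y
    rw [Submodule.mem_map, Submodule.mem_orthogonal_singleton_iff_inner_right]
    constructor
    · rintro ⟨h, hh, rfl⟩
      exact (he h).1 (Submodule.mem_orthogonal_singleton_iff_inner_right.1 hh)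
    · intro hy
      refine ⟨e.symm y, Submodule.mem_orthogonal_singleton_iff_inner_right.2 ((he _).2 ?_), ?_⟩
      · rwa [e.apply_symm_apply]
      · exact e.apply_symm_apply y
  set E : Submodule.orthogonal (ℝ ∙ ν) ≃ₗᵢ[ℝ] Submodule.orthogonal (ℝ ∙ ν') :=
    (e.submoduleMap _).trans (LinearIsometryEquiv.ofEq _ _ hmap) with hE
  have hEc : ∀ h, (E h : Rn n) = e (h : Rn n) := fun h => rfl
  have hmp : (hyperplaneLebesgue ν).map E = hyperplaneLebesgue ν' :=
    map_orthonormalBasis_addHaar _ _ E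
  have hemb : MeasurableEmbedding E := E.toHomeomorph.measurableEmbedding
  have hpre : E ⁻¹' ball 0 ε = ball 0 ε := by
    ext h
    simp
  have hdisc : (hyperplaneDisc ν ε).map E = hyperplaneDisc ν' ε := by
    unfold hyperplaneDisc
    rw [Measure.map_smul, ← hmp, hemb.map_apply, hemb.restrict_map, hpre]
  have h1 : ∫ y, u y ∂(uniformDisc z ν' ε) = ∫ h, u (z + (h : Rn n)) ∂(hyperplaneDisc ν' ε) :=
    integral_map (measurable_add_coe z ν').aemeasurable hm.aestronglyMeasurable
  rw [h1, ← hdisc, hemb.integral_map]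
  simp only [hEc]

/-- A coupling of two discs by a linear isometry, in which the increments `y` and `-y` are taken
together. -/
theorem uniformDisc_sub_le_symm (hε : 0 < ε) {K : ℝ} (hm : Measurable u) (hK : ∀ y, |u y| ≤ K)
    {x z ν ν' : Rn n} (e : Rn n ≃ₗᵢ[ℝ] Rn n) (he : ∀ h, inner ℝ ν h = 0 ↔ inner ℝ ν' (e h) = 0)
    {T : ℝ} (hT : ∀ y : Rn n, ‖y‖ < ε → inner ℝ ν y = 0 →
      (u (x + y) - u (z + e y)) + (u (x + -y) - u (z + e (-y))) ≤ 2 * T) :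
    ∫ y, u y ∂(uniformDisc x ν ε) - ∫ y, u y ∂(uniformDisc z ν' ε) ≤ T := by
  have := isProbabilityMeasure_hyperplaneDisc hε ν
  have h1 : ∀ (y : Rn n) (e : Rn n ≃ₗᵢ[ℝ] Rn n),
      Integrable (fun w : Submodule.orthogonal (ℝ ∙ ν) => u (y + e (w : Rn n)))
        (hyperplaneDisc ν ε) := fun y e =>
    integrable_of_abs_le (hm.comp (measurable_const.add
      (e.continuous.measurable.comp measurable_subtype_coe))) (fun w => hK _)
  have hneg : ∀ h : Rn n, inner ℝ ν h = 0 ↔ inner ℝ ν (LinearIsometryEquiv.neg ℝ h) = 0 := by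
    intro h
    simp
  have e1 := integral_uniformDisc (ε := ε) hm x (LinearIsometryEquiv.refl ℝ _)
    (fun h => Iff.rfl : ∀ h, inner ℝ ν h = 0 ↔ _)
  have e2 := integral_uniformDisc (ε := ε) hm z e he
  have e3 := integral_uniformDisc (ε := ε) hm x (LinearIsometryEquiv.neg ℝ) hneg
  have e4 := integral_uniformDisc (ε := ε) hm z ((LinearIsometryEquiv.neg ℝ).trans e)
    (fun h => (hneg h).trans (he _))
  have i1 := h1 x (LinearIsometryEquiv.refl ℝ _)
  have i2 := h1 z e
  have i3 := h1 x (LinearIsometryEquiv.neg ℝ)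
  have i4 := h1 z ((LinearIsometryEquiv.neg ℝ).trans e)
  have key := integral_mono_ae ((i1.sub i2).add (i3.sub i4)) (integrable_const (2 * T)) (by
    filter_upwards [ae_hyperplaneDisc_norm_lt ν] with w hw
    exact hT w hw (Submodule.mem_orthogonal_singleton_iff_inner_right.1 w.2))
  have h5 := integral_add (i1.sub i2) (i3.sub i4)
  have h6 := integral_sub i1 i2
  have h7 := integral_sub i3 i4
  have h8 : ∫ _, (2 * T) ∂(hyperplaneDisc ν ε) = 2 * T := by simp
  simp only [Pi.sub_apply] at h5
  rw [h6, h7, ← e1, ← e2, ← e3, ← e4] at h5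
  have key' := h5.symm.le.trans (key.trans h8.le)
  linarith

theorem uniformDisc_sub_le (hε : 0 < ε) {K : ℝ} (hm : Measurable u) (hK : ∀ y, |u y| ≤ K)
    {x z : Rn n} (ν ν' : Rn n) {T : ℝ}
    (hT : ∀ X ∈ closedBall x ε, ∀ Z ∈ closedBall z ε, u X - u Z ≤ T) :
    ∫ y, u y ∂(uniformDisc x ν ε) - ∫ y, u y ∂(uniformDisc z ν' ε) ≤ T := by
  have := isProbabilityMeasure_uniformDisc hε x ν
  have := isProbabilityMeasure_uniformDisc hε z ν'
  exact integral_sub_integral_le (integrable_of_abs_le hm hK) (integrable_of_abs_le hm hK)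
    (ae_uniformDisc_mem x ν) (ae_uniformDisc_mem z ν') hT

end Disc

/-! ### The gain conditions for the game (d) -/

section DiscGame

variable {n : ℕ} {ε α : ℝ} {Ω : Set (Rn n)} {u : Rn n → ℝ} {x z : Rn n}

theorem sub_le_of_disc (hε : 0 < ε) (hα : 0 < α) (hα1 : α ≤ 1)
    (hu : SatisfiesDPP (discTugOfWar α ε) (discTugOfWar α ε) Ω u) {K : ℝ} (hm : Measurable u)
    (hK : ∀ y, |u y| ≤ K) (hx : x ∈ Ω) (hz : z ∈ Ω) {v : Rn n} (hv : ‖v‖ = 1) {T : ℝ}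
    (h : ∀ h g : Rn n, 0 < ‖h‖ → ‖h‖ ≤ ε → 0 < ‖g‖ → ‖g‖ ≤ ε → ∃ h' g' : Rn n,
      0 < ‖h'‖ ∧ ‖h'‖ ≤ ε ∧ 0 < ‖g'‖ ∧ ‖g'‖ ≤ ε ∧
      α * ((u (x + h) - u (z + g)) + (u (x + h') - u (z + g'))) + (1 - α) *
        ((∫ y, u y ∂(uniformDisc x h ε) - ∫ y, u y ∂(uniformDisc z g ε)) +
        (∫ y, u y ∂(uniformDisc x h' ε) - ∫ y, u y ∂(uniformDisc z g' ε))) ≤ 2 * T) :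
    u x - u z ≤ T := by
  have hprob := fun y ν : Rn n => isProbabilityMeasure_uniformDisc hε y ν
  have hvε : ‖ε • v‖ = ε := by rw [norm_smul, hv, mul_one, Real.norm_of_nonneg hε.le]
  refine hu.sub_le hK hx hz (fun y => ⟨_, ε • v, hvε.symm ▸ hε, hvε.le, rfl⟩) ?_ ?_
  · rintro y _ _ ⟨ν, _, _, rfl⟩
    have := hprob y ν
    exact isProbabilityMeasure_mix hα.le hα1 _ _
  · rintro _ ⟨ν, hν, hνε, rfl⟩ _ ⟨ξ, hξ, hξε, rfl⟩
    obtain ⟨h', g', hh0, hh', hg0, hg', hle⟩ := h ν ξ hν hνε hξ hξε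
    refine ⟨_, ⟨h', hh0, hh', rfl⟩, _, ⟨g', hg0, hg', rfl⟩, ?_⟩
    simp only [integral_mix hα.le hα1 hm hK]
    linarith

/-- Since `α` is constant and positive, no dichotomy is needed. The answering players win the toss
and play tug-of-war with probability `α / 2`; the discs merely must not exceed `T`. -/
theorem nearGain_of_disc (hε : 0 < ε) (hα : 0 < α) (hα1 : α ≤ 1)
    (hu : SatisfiesDPP (discTugOfWar α ε) (discTugOfWar α ε) Ω u) {K : ℝ} (hm : Measurable u)
    (hK : ∀ y, |u y| ≤ K) (hx : x ∈ Ω) (hz : z ∈ Ω) :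
    NearGain (α / 2) ε (fun _ => True) u x z := by
  intro hxz T s hs hT hTs
  have hd0 : 0 < ‖x - z‖ := norm_pos_iff.2 (sub_ne_zero.2 hxz)
  obtain ⟨v, hv, hdv⟩ : ∃ v : Rn n, ‖v‖ = 1 ∧ x - z = ‖x - z‖ • v := by
    refine ⟨(1 / ‖x - z‖) • (x - z), ?_, ?_⟩
    · rw [norm_smul, Real.norm_of_nonneg (by positivity)]; field_simp
    · rw [smul_smul, mul_one_div_cancel hd0.ne', one_smul]
  have hnv : ∀ r : ℝ, 0 ≤ r → ‖r • v‖ = r := fun r hr => by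
    rw [norm_smul, hv, mul_one, Real.norm_of_nonneg hr]
  -- it suffices to let both points take the same step towards each other
  suffices hstep : ∃ r, 0 < r ∧ r ≤ ε ∧ level (fun _ => True) ε (x + -(r • v)) (z + r • v) <
      level (fun _ => True) ε x z by
    obtain ⟨r, hr0, hr, hlt⟩ := hstep
    apply sub_le_of_disc hε hα hα1 hu hm hK hx hz hv
    intro h g hh0 hh hg0 hg
    have hn := hnv r hr0.le
    have hn' : ‖-(r • v)‖ = r := by rw [norm_neg, hn]
    refine ⟨-(r • v), r • v, by rwa [hn'], by rwa [hn'], by rwa [hn], by rwa [hn], ?_⟩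
    have k1 := hT (x + h) (by simpa using hh) (z + g) (by simpa using hg)
    have k2 := hTs (x + -(r • v)) (by rw [mem_closedBall, dist_eq_norm, add_sub_cancel_left, hn']; exact hr)
      (z + r • v) (by rw [mem_closedBall, dist_eq_norm, add_sub_cancel_left, hn]; exact hr) hlt
    have k3 := uniformDisc_sub_le hε hm hK h g hT
    have k4 := uniformDisc_sub_le hε hm hK (-(r • v)) (r • v) hT
    have k5 := mul_le_mul_of_nonneg_left (add_le_add k1 k2) hα.le
    have k6 := mul_le_mul_of_nonneg_left (add_le_add k3 k4) (sub_nonneg.2 hα1)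
    linarith
  have hdiff : ∀ r : ℝ, x + -(r • v) - (z + r • v) = (‖x - z‖ - 2 * r) • v := by
    intro r
    rw [sub_smul, ← hdv]
    module
  rcases le_or_gt ‖x - z‖ (3 / 2 * ε) with hd | hd
  · refine ⟨‖x - z‖ / 2, by positivity, by linarith, ?_⟩
    have : x + -((‖x - z‖ / 2) • v) = z + (‖x - z‖ / 2) • v := by
      rw [← sub_eq_zero, hdiff]
      simp [mul_div_cancel₀]
    rw [this, level_self]
    exact level_pos hxz
  · refine ⟨ε / 4, by positivity, by linarith, ?_⟩
    rcases level_cases (fun _ => True) (ε := ε) hxz with hl | hl | hl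
    · linarith [hl.2.2]
    · linarith [hl.2]
    · apply level_lt_of_norm_le hε hl.1
      rw [hdiff, hnv _ (by linarith)]
      linarith

/-- The reflection that exchanges two almost opposite unit vectors `a` and `c` hardly moves the
vectors orthogonal to `a`. -/
theorem norm_sub_reflection_sq_le {a c v y : Rn n} {t : ℝ} (ha : ‖a‖ = 1) (hc : ‖c‖ = 1)
    (hv : ‖v‖ = 1) (ht1 : t ≤ 1 / 8) (hav : 1 - t ≤ inner ℝ a v)
    (hcv : inner ℝ c v ≤ -(1 - t)) (hy : inner ℝ a y = 0) (hyε : ‖y‖ ≤ ε) :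
    ‖y - Submodule.reflection (ℝ ∙ (a - c))ᗮ y‖ ^ 2 ≤ 16 * t * ε ^ 2 := by
  set w := a - c with hw
  have hwv : 2 * (1 - t) ≤ ‖w‖ := by
    have h1 := real_inner_le_norm w v
    rw [hv, mul_one, hw, inner_sub_left] at h1
    linarith
  have hw2 : (2 * (1 - t)) ^ 2 ≤ ‖w‖ ^ 2 := by
    have : 0 ≤ 1 - t := by linarith
    gcongr
  have hw0 : 0 < ‖w‖ := by linarith
  have hpar := parallelogram_law_with_norm ℝ a c
  rw [ha, hc, ← hw] at hpar
  -- By the parallelogram law, `‖a + c‖ ^ 2 = 4 - ‖w‖ ^ 2 ≤ 4 - 4 * (1 - t) ^ 2`.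
  have hac : ‖a + c‖ ^ 2 ≤ 8 * t := by nlinarith [sq_nonneg t]
  have hin : inner ℝ w y = -inner ℝ (a + c) y := by
    rw [hw, inner_sub_left, inner_add_left, hy]; ring
  have hin2 : inner ℝ w y ^ 2 ≤ 8 * t * ε ^ 2 := by
    rw [hin, neg_sq]
    calc inner ℝ (a + c) y ^ 2 = |inner ℝ (a + c) y| ^ 2 := (sq_abs _).symm
      _ ≤ (‖a + c‖ * ‖y‖) ^ 2 := by gcongr; exact abs_real_inner_le_norm _ _
      _ = ‖a + c‖ ^ 2 * ‖y‖ ^ 2 := by ring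
      _ ≤ 8 * t * ε ^ 2 := by
        have : ‖y‖ ^ 2 ≤ ε ^ 2 := by gcongr
        have h0 := sq_nonneg ‖a + c‖
        have h1 := sq_nonneg ‖y‖
        apply mul_le_mul hac this h1 (by linarith)
  have hform : y - Submodule.reflection (ℝ ∙ w)ᗮ y = (2 * (inner ℝ w y / ‖w‖ ^ 2)) • w := by
    rw [Submodule.reflection_orthogonal_apply, Submodule.reflection_singleton_apply]
    simp only [RCLike.ofReal_real_eq_id, id_eq, two_smul]
    module
  rw [hform, norm_smul, mul_pow, Real.norm_eq_abs, sq_abs]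
  have : (2 * (inner ℝ w y / ‖w‖ ^ 2)) ^ 2 * ‖w‖ ^ 2 = 4 * inner ℝ w y ^ 2 / ‖w‖ ^ 2 := by
    field_simp; ring
  rw [this, div_le_iff₀ (by positivity)]
  have h2 : 2 ≤ ‖w‖ ^ 2 := by nlinarith
  have h3 : 0 ≤ 16 * t * ε ^ 2 := by nlinarith [sq_nonneg (inner ℝ w y)]
  nlinarith

/-- The reflection takes the unit normal of one disc to that of the other and so couples the discs.
Pairing `y` with `-y` removes the first-order terms; the concave term is dropped, and only the
squared displacement remains. -/
theorem uniformDisc_sub_le_far (hε : 0 < ε) {K : ℝ} (hm : Measurable u) (hK : ∀ y, |u y| ≤ K)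
    {p σ d T Λ : ℝ} {v a b h g : Rn n} (hp1 : p ≤ 1) (hΛ : 0 < Λ) (hh : 0 < ‖h‖) (hg : 0 < ‖g‖)
    (hu : ∀ h g : Rn n, ‖h‖ ≤ ε → ‖g‖ ≤ ε →
      u (x + h) - u (z + g) ≤ T + Λ * quadIncrement p σ ε d v a b h g) {B : ℝ}
    (hB : ∀ y : Rn n, ‖y‖ ≤ ε → inner ℝ h y = 0 →
      ‖y - Submodule.reflection (ℝ ∙ (‖h‖⁻¹ • h - ‖g‖⁻¹ • g))ᗮ y‖ ^ 2 ≤ B) :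
    ∫ y, u y ∂(uniformDisc x h ε) - ∫ y, u y ∂(uniformDisc z g ε) ≤
      T + Λ * (B + σ * ε ^ 2) := by
  set e := Submodule.reflection (ℝ ∙ (‖h‖⁻¹ • h - ‖g‖⁻¹ • g))ᗮ with he
  have hunit : ∀ w : Rn n, 0 < ‖w‖ → ‖‖w‖⁻¹ • w‖ = 1 := fun w hw => by
    rw [norm_smul, norm_inv, norm_norm, inv_mul_cancel₀ hw.ne']
  have heh : e (‖h‖⁻¹ • h) = ‖g‖⁻¹ • g :=
    Submodule.reflection_sub ((hunit h hh).trans (hunit g hg).symm)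
  have horth : ∀ y, inner ℝ h y = 0 ↔ inner ℝ g (e y) = 0 := by
    intro y
    have h1 : inner ℝ (‖g‖⁻¹ • g) (e y) = inner ℝ (‖h‖⁻¹ • h) y := by
      rw [← heh, e.inner_map_map]
    rw [real_inner_smul_left, real_inner_smul_left] at h1
    constructor
    · intro h2
      rw [h2, mul_zero] at h1
      exact (mul_eq_zero.1 h1).resolve_left (inv_pos.2 hg).ne'
    · intro h2
      rw [h2, mul_zero] at h1
      exact (mul_eq_zero.1 h1.symm).resolve_left (inv_pos.2 hh).ne'
  refine uniformDisc_sub_le_symm hε hm hK e horth ?_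
  intro y hy hhy
  have hey : ‖e y‖ ≤ ε := by rw [e.norm_map]; exact hy.le
  have k1 := hu y (e y) hy.le hey
  have k2 := hu (-y) (e (-y)) (by rw [norm_neg]; exact hy.le) (by rw [map_neg, norm_neg]; exact hey)
  have k3 : quadIncrement p σ ε d v a b y (e y) + quadIncrement p σ ε d v a b (-y) (e (-y)) ≤
      2 * (B + σ * ε ^ 2) := by
    have k4 : -y - -e y = -(y - e y) := by abel
    have k5 : 0 ≤ (1 - p) * inner ℝ (y - e y) v ^ 2 := mul_nonneg (by linarith) (sq_nonneg _)
    unfold quadIncrement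
    rw [map_neg, k4]
    simp only [inner_neg_left, inner_neg_right, norm_neg, neg_sq]
    linarith [hB y hy.le hhy]
  have k6 := mul_le_mul_of_nonneg_left k3 hΛ.le
  linarith

/-- If both steps are almost maximal and point apart, both are reversed: tug-of-war gains `2 * ε ^
2` with weight `α`, while the discs are almost parallel and cost only a small multiple of `α * ε ^
2`. Otherwise both answers pull with full length; the discs may cost `4 * ε ^ 2` each, but the
first-order gain of order `α ^ 2 * d * ε` exceeds this for `6400 / α ^ 2 * ε ≤ d`. -/
theorem farGain_of_disc (hε : 0 < ε) (hα : 0 < α) (hα1 : α ≤ 1)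
    (hu : SatisfiesDPP (discTugOfWar α ε) (discTugOfWar α ε) Ω u) {K : ℝ} (hm : Measurable u)
    (hK : ∀ y, |u y| ≤ K) (hx : x ∈ Ω) (hz : z ∈ Ω) {p : ℝ} (hp : 0 < p) (hp1 : p ≤ 1 / 16) :
    FarGain p (6400 / α ^ 2) (α / 512) (α / 4) ε u x z := by
  intro T Λ d v a b hΛ hd hv ha hb hinc
  have hd0 : 0 < d := lt_of_lt_of_le (by positivity) hd
  have hdα : 6400 * ε ≤ d * α ^ 2 := by
    rw [div_mul_eq_mul_div, div_le_iff₀ (by positivity)] at hd; exact hd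
  have hαε : 0 < α * ε ^ 2 := by positivity
  have hαε1 : α * ε ^ 2 ≤ ε ^ 2 := by nlinarith [sq_nonneg ε]
  have hB4 : ∀ (w : Rn n) (y : Rn n), ‖y‖ ≤ ε →
      ‖y - Submodule.reflection (ℝ ∙ w)ᗮ y‖ ^ 2 ≤ 4 * ε ^ 2 := by
    intro w y hy
    have h1 := norm_sub_le y (Submodule.reflection (ℝ ∙ w)ᗮ y)
    rw [LinearIsometryEquiv.norm_map] at h1
    have h2 : ‖y - Submodule.reflection (ℝ ∙ w)ᗮ y‖ ^ 2 ≤ (2 * ε) ^ 2 := by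
      gcongr
      linarith
    linarith
  have hinner : ∀ h : Rn n, ‖h‖ ≤ ε → inner ℝ h v ≤ ε ∧ -ε ≤ inner ℝ h v := by
    intro h hh
    have h1 := abs_le.1 (abs_real_inner_le_norm h v)
    rw [hv, mul_one] at h1
    exact ⟨h1.2.trans hh, by linarith [h1.1]⟩
  apply sub_le_of_disc hε hα hα1 hu hm hK hx hz hv
  intro h g hh0 hh hg0 hg
  have k1 := hinc h g hh hg
  have h1α : 0 ≤ 1 - α := by linarith
  by_cases hnear : (1 - α / 64) * ε ≤ inner ℝ h v ∧ inner ℝ g v ≤ -((1 - α / 64) * ε)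
  · have hh0' : 0 < ‖-h‖ := by rwa [norm_neg]
    have hg0' : 0 < ‖-g‖ := by rwa [norm_neg]
    have hh' : ‖-h‖ ≤ ε := by rwa [norm_neg]
    have hg' : ‖-g‖ ≤ ε := by rwa [norm_neg]
    refine ⟨-h, -g, hh0', hh', hg0', hg', ?_⟩
    have k2 := hinc (-h) (-g) hh' hg'
    have k3 := quadIncrement_add_neg_le (a := a) (b := b) (d := d) (σ := α / 512) hε hp hp1
      (by linarith) (by linarith : α / 64 ≤ 1 / 8) hh hg hnear.1 hnear.2
    have hscale : ∀ w v : Rn n, 0 < ‖w‖ → ‖w‖ ≤ ε → (1 - α / 64) * ε ≤ inner ℝ w v →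
        1 - α / 64 ≤ inner ℝ (‖w‖⁻¹ • w) v := by
      intro w v hw0 hw hwv
      rw [real_inner_smul_left, inv_mul_eq_div, le_div_iff₀ hw0]
      have : (1 - α / 64) * ‖w‖ ≤ (1 - α / 64) * ε :=
        mul_le_mul_of_nonneg_left hw (by linarith)
      linarith
    have hunit : ∀ w : Rn n, 0 < ‖w‖ → ‖‖w‖⁻¹ • w‖ = 1 := fun w hw => by
      rw [norm_smul, norm_inv, norm_norm, inv_mul_cancel₀ hw.ne']
    have hdisc : ∀ h g v' : Rn n, ‖v'‖ = 1 → 0 < ‖h‖ → ‖h‖ ≤ ε → 0 < ‖g‖ → ‖g‖ ≤ ε →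
        (1 - α / 64) * ε ≤ inner ℝ h v' → (1 - α / 64) * ε ≤ inner ℝ g (-v') →
        ∫ y, u y ∂(uniformDisc x h ε) - ∫ y, u y ∂(uniformDisc z g ε) ≤
          T + Λ * (16 * (α / 64) * ε ^ 2 + α / 512 * ε ^ 2) := by
      intro h g v' hv' hh0 hh hg0 hg hhv hgv
      refine uniformDisc_sub_le_far hε hm hK (by linarith) hΛ hh0 hg0 hinc ?_
      intro y hy hhy
      refine norm_sub_reflection_sq_le (v := v') (hunit h hh0) (hunit g hg0) hv' (by linarith)
        (hscale h v' hh0 hh hhv) ?_ ?_ hy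
      · have := hscale g (-v') hg0 hg hgv
        rw [inner_neg_right] at this
        linarith
      · rw [real_inner_smul_left, hhy, mul_zero]
    have k4 := hdisc h g v hv hh0 hh hg0 hg hnear.1 (by rw [inner_neg_right]; linarith [hnear.2])
    have k5 := hdisc (-h) (-g) (-v) (by rwa [norm_neg]) hh0' hh' hg0' hg'
      (by rw [inner_neg_neg]; exact hnear.1)
      (by rw [neg_neg, inner_neg_left]; linarith [hnear.2])
    have k6 := mul_le_mul_of_nonneg_left k3 hΛ.le
    have k7 : α * ((u (x + h) - u (z + g)) + (u (x + -h) - u (z + -g))) ≤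
        α * (2 * T + Λ * (-2 * ε ^ 2)) := mul_le_mul_of_nonneg_left (by linarith) hα.le
    have k8 := mul_le_mul_of_nonneg_left (add_le_add k4 k5) h1α
    have k9 : 0 < Λ * (α * ε ^ 2) := by positivity
    have k10 : 0 < α * (Λ * (α * ε ^ 2)) := by positivity
    linarith
  · have hvε : ‖ε • v‖ = ε := by rw [norm_smul, hv, mul_one, Real.norm_of_nonneg hε.le]
    have hvε' : ‖-(ε • v)‖ = ε := by rw [norm_neg, hvε]
    refine ⟨-(ε • v), ε • v, by rwa [hvε'], hvε'.le, by rwa [hvε], hvε.le, ?_⟩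
    have k2 := hinc (-(ε • v)) (ε • v) hvε'.le hvε.le
    have hvv : inner ℝ (ε • v) v = ε := by
      rw [real_inner_smul_left, real_inner_self_eq_norm_sq, hv]; ring
    have k3 := quadIncrement_add_le_of_pull (a := a) (b := b) (σ := α / 512) (p := p) (v := v)
      (l := α / 64) hε (by linarith) (by positivity) (by linarith) hd0 ha hb hh hg hvε'.le hvε.le (by
        rw [inner_neg_left, hvv]
        rcases not_and_or.1 hnear with h1 | h1
        · linarith [(hinner g hg).2]
        · linarith [(hinner h hh).1])
    have k4 := uniformDisc_sub_le_far hε hm hK (by linarith) hΛ hh0 hg0 hinc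
      (fun y hy _ => hB4 _ y hy)
    have k5 := uniformDisc_sub_le_far hε hm hK (by linarith) hΛ (h := -(ε • v)) (g := ε • v)
      (by rwa [hvε']) (by rwa [hvε]) hinc (fun y hy _ => hB4 _ y hy)
    have k6 := mul_le_mul_of_nonneg_left k3 hΛ.le
    have k7 : α * ((u (x + h) - u (z + g)) + (u (x + -(ε • v)) - u (z + ε • v))) ≤
        α * (2 * T + Λ * (d * ε * (4 * (α / 512) - 2 * (α / 64)) + 9 * ε ^ 2)) :=
      mul_le_mul_of_nonneg_left (by linarith) hα.le
    have k8 := mul_le_mul_of_nonneg_left (add_le_add k4 k5) h1α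
    have k9 : α * (d * ε * (4 * (α / 512) - 2 * (α / 64)) + 9 * ε ^ 2) +
        (1 - α) * (2 * (4 * ε ^ 2 + α / 512 * ε ^ 2)) ≤ -(α / 2) * ε ^ 2 := by
      have h1 : 6400 * ε * ε ≤ d * α ^ 2 * ε := by gcongr
      have h2 : 0 ≤ α * (α * ε ^ 2) := by positivity
      linarith
    have k10 := mul_le_mul_of_nonneg_left k9 hΛ.le
    linarith

end DiscGame

/-! ### The theorem -/

theorem theorem2p1 (n : ℕ) (hn : 2 ≤ n) :
    ∃ δ : ℝ, 0 < δ ∧ δ < 1 ∧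
      (∃ C C' : ℝ, 0 < C ∧ 0 < C' ∧
        ∀ (ε R : ℝ) (x₀ : Rn n) (Ω : Set (Rn n)) (u : Rn n → ℝ),
          0 < ε → 0 < R → IsOpen Ω → Bornology.IsBounded Ω → ball x₀ (2 * R) ⊆ Ω →
          Measurable u → (∃ K : ℝ, ∀ y, |u y| ≤ K) →
          (SatisfiesDPP (tugOfWar ε) (tugOfWar ε) Ω u ∨
            SatisfiesDPP (randomWalk ε) (randomWalk ε) Ω u ∨
            ∃ α : Rn n → ℝ, Measurable α ∧ (∀ y ∈ Ω, 0 ≤ α y ∧ α y ≤ 1) ∧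
              SatisfiesDPP (noisyTugOfWar α ε) (noisyTugOfWar α ε) Ω u) →
          AsymptoticHolder δ C C' ε u x₀ R) ∧
      (∀ α : ℝ, 0 < α → α ≤ 1 → ∃ C C' : ℝ, 0 < C ∧ 0 < C' ∧
        ∀ (ε R : ℝ) (x₀ : Rn n) (Ω : Set (Rn n)) (u : Rn n → ℝ),
          0 < ε → 0 < R → IsOpen Ω → Bornology.IsBounded Ω → ball x₀ (2 * R) ⊆ Ω →
          Measurable u → (∃ K : ℝ, ∀ y, |u y| ≤ K) →
          SatisfiesDPP (discTugOfWar α ε) (discTugOfWar α ε) Ω u →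
          AsymptoticHolder δ C C' ε u x₀ R) := by
  -- The largest value allowed in `farGain_of_noisy`, used there for `t` as well. The disc game only
  -- needs `p ≤ 1 / 16`, so this one exponent serves all games and does not depend on `α`.
  set p : ℝ := (1 / 4) ^ n / 256 with hp
  have hp0 : 0 < p := by positivity
  have hQ1 : (1 / 4 : ℝ) ^ n ≤ 1 := pow_le_one₀ (by norm_num) (by norm_num)
  have hc1 : (1 / 20 : ℝ) ^ n / 4 ≤ 1 := by
    have : (1 / 20 : ℝ) ^ n ≤ 1 := pow_le_one₀ (by norm_num) (by norm_num)
    linarith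
  refine ⟨2 * p, by positivity, by linarith, ?_, ?_⟩
  · obtain ⟨C, C', hC, hC', H⟩ := exists_asymptoticHolder (n := n) (p := p)
      (c := (1 / 20) ^ n / 4) (N := 100 / p) (σ := p / 8) (κ := (1 / 4) ^ n / 64) hp0
      (by linarith) (by positivity) hc1 (by positivity) (by positivity)
    refine ⟨C, C', hC, hC', ?_⟩
    intro ε R x₀ Ω u hε hR _ _ hΩ hm hbdd hu
    obtain ⟨α, hαm, hα, hu⟩ : ∃ α : Rn n → ℝ, Measurable α ∧ (∀ y ∈ Ω, 0 ≤ α y ∧ α y ≤ 1) ∧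
        SatisfiesDPP (noisyTugOfWar α ε) (noisyTugOfWar α ε) Ω u := by
      rcases hu with hu | hu | hu
      · rw [tugOfWar_eq_noisyTugOfWar] at hu
        exact ⟨_, measurable_const, fun _ _ => ⟨by norm_num, by norm_num⟩, hu⟩
      · rw [randomWalk_eq_noisyTugOfWar hε] at hu
        exact ⟨_, measurable_const, fun _ _ => ⟨by norm_num, by norm_num⟩, hu⟩
      · exact hu
    obtain ⟨K, hK⟩ := id hbdd
    exact H ε R x₀ u (fun y => 1 / 2 ≤ α y) hε hR hbdd fun x hx z hz =>
      ⟨nearGain_of_noisy hε hαm hα hu hm hK (hΩ hx) (hΩ hz),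
        farGain_of_noisy hε hα hu hm hK (hΩ hx) (hΩ hz) hp0 le_rfl (by positivity) hp0 le_rfl le_rfl⟩
  · intro α hα hα1
    obtain ⟨C, C', hC, hC', H⟩ := exists_asymptoticHolder (n := n) (p := p)
      (c := α / 2) (N := 6400 / α ^ 2) (σ := α / 512) (κ := α / 4) hp0
      (by linarith) (by positivity) (by linarith) (by positivity) (by positivity)
    refine ⟨C, C', hC, hC', ?_⟩
    intro ε R x₀ Ω u hε hR _ _ hΩ hm hbdd hu
    obtain ⟨K, hK⟩ := id hbdd
    exact H ε R x₀ u (fun _ => True) hε hR hbdd fun x hx z hz =>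
      ⟨nearGain_of_disc hε hα hα1 hu hm hK (hΩ hx) (hΩ hz),
        farGain_of_disc hε hα hα1 hu hm hK (hΩ hx) (hΩ hz) hp0 (by linarith)⟩
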